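/- Let $M$ be a smooth manifold (finite-dimensional, Hausdorff, second countable) and let $\Theta$ be a smooth bivector field on $M$, that is, a skew-symmetric $(2,0)$ tensor field, of constant rank. View $\Theta$ as a bundle morphism $T^*M\to TM$, $\xi\mapsto\Theta(\xi,\cdot)$, and let $\mathrm{Im}\,\Theta\subseteq TM$ be its image, a smooth distribution. At each point $x$, with $W=\mathrm{Im}\,\Theta_x$, the restriction of $\Theta_x$ to $W$ is the nondegenerate $(2,0)$ tensor $\Theta_W$ in $W$ given by $\Theta_W(\eta,\eta')=\Theta_x(\xi,\xi')$, where $\xi,\xi'\in T_x^*M$ are any extensions of $\eta,\eta'\in W^*$; its inverse is the skew-symmetric bilinear form $\zeta_x$ on $W$ corresponding to the inverse of the isomorphism $W^*\to W$, $\eta\mapsto\Theta_W(\eta,\cdot)$. Call $\Theta$ locally constant if around each point of $M$ there are local coordinates in which the components of $\Theta$ are constant, and integrable if $\nabla\Theta=0$ for some smooth torsion-free connection $\nabla$ on $M$. Call a distribution integrable if each point of $M$ lies in an integral manifold of it; its leaves are its maximal connected integral manifolds. Then the following three conditions are equivalent: (a) $\Theta$ is locally constant; (b) $\Theta$ is integrable;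 (c) the distribution $\mathrm{Im}\,\Theta$ is integrable and the $2$-form that $\zeta$ defines on each leaf of $\mathrm{Im}\,\Theta$ is closed. -/

import Mathlib

open Set Bundle NormedSpace
open scoped Manifold ContDiff

noncomputable section

namespace BivectorFields

section LinearAlgebra

variable {V : Type*} [AddCommGroup V] [Module ℝ V] [TopologicalSpace V] [IsTopologicalAddGroup V]
  [ContinuousSMul ℝ V] [T2Space V] [FiniteDimensional ℝ V]

/-- A (2,0) tensor in a finite-dimensional real vector space `V`, viewed as the linear map
`V* → V` sending `ξ` to the vector `Θ(ξ, ·) ∈ V** = V`; thus `Θ(ξ, η) = η (Θ ξ)`. This predicate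
says that the tensor is skew-symmetric, i.e. a bivector. -/
def IsSkew (Θ : (V →L[ℝ] ℝ) →L[ℝ] V) : Prop :=
  ∀ ξ η : V →L[ℝ] ℝ, η (Θ ξ) = -ξ (Θ η)

/-- The image `Im Θ ⊆ V` of a (2,0) tensor. -/
def im (Θ : (V →L[ℝ] ℝ) →L[ℝ] V) : Submodule ℝ V :=
  LinearMap.range (Θ : (V →L[ℝ] ℝ) →ₗ[ℝ] V)

/-- A linear projection of `V` onto a subspace `W`. -/
def proj (W : Submodule ℝ V) : V →L[ℝ] W :=
  LinearMap.toContinuousLinearMap (W.projectionOnto _ W.exists_isCompl.choose_spec)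

theorem proj_apply (W : Submodule ℝ V) (w : W) : proj W (w : V) = w :=
  Submodule.projectionOnto_apply_left W.exists_isCompl.choose_spec w

/-- The restriction of a (2,0) tensor `Θ` to `W = Im Θ`: the (2,0) tensor in `W`, viewed as a map
`W* → W`, which sends `η` to `Θ ξ`, where `ξ = η ∘ proj W` is an extension of `η` to `V`. See
`restrict_eq` and `restrict_form` for independence of the extension. -/
def restrict (Θ : (V →L[ℝ] ℝ) →L[ℝ] V) : (im Θ →L[ℝ] ℝ) →ₗ[ℝ] im Θ where
  toFun η := ⟨Θ (η ∘L proj (im Θ)), LinearMap.mem_range_self (Θ : (V →L[ℝ] ℝ) →ₗ[ℝ] V) _⟩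
  map_add' η η' := by
    apply Subtype.ext
    simp [ContinuousLinearMap.add_comp]
  map_smul' c η := by
    apply Subtype.ext
    simp [ContinuousLinearMap.smul_comp]

theorem map_eq_of_eqOn {Θ : (V →L[ℝ] ℝ) →L[ℝ] V} (hΘ : IsSkew Θ) {ξ ξ' : V →L[ℝ] ℝ}
    (h : ∀ w ∈ im Θ, ξ w = ξ' w) : Θ ξ = Θ ξ' := by
  rw [← sub_eq_zero, ← map_sub]
  by_contra hne
  have hdual : ∀ η : V →L[ℝ] ℝ, η (Θ (ξ - ξ')) = 0 := by
    intro η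
    rw [hΘ]
    have := h (Θ η) (LinearMap.mem_range_self (Θ : (V →L[ℝ] ℝ) →ₗ[ℝ] V) η)
    simp [this]
  exact hne ((Module.forall_dual_apply_eq_zero_iff ℝ _).1
    fun φ => hdual (LinearMap.toContinuousLinearMap φ))

theorem restrict_eq {Θ : (V →L[ℝ] ℝ) →L[ℝ] V} (hΘ : IsSkew Θ) (η : im Θ →L[ℝ] ℝ)
    (ξ : V →L[ℝ] ℝ) (hξ : ∀ w : im Θ, ξ w = η w) : (restrict Θ η : V) = Θ ξ := by
  refine map_eq_of_eqOn hΘ fun w hw => ?_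
  have := hξ ⟨w, hw⟩
  simp only at this
  rw [this, ContinuousLinearMap.comp_apply, proj_apply (im Θ) ⟨w, hw⟩]

/-- `Θ_W(η, η') = Θ(ξ, ξ')` for any extensions `ξ, ξ'` of `η, η'` to `V`. -/
theorem restrict_form {Θ : (V →L[ℝ] ℝ) →L[ℝ] V} (hΘ : IsSkew Θ) (η η' : im Θ →L[ℝ] ℝ)
    (ξ ξ' : V →L[ℝ] ℝ) (hξ : ∀ w : im Θ, ξ w = η w) (hξ' : ∀ w : im Θ, ξ' w = η' w) :
    η' (restrict Θ η) = ξ' (Θ ξ) := by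
  rw [← hξ', restrict_eq hΘ η ξ hξ]

/-- The restriction of a bivector to its image is nondegenerate. -/
theorem restrict_bijective {Θ : (V →L[ℝ] ℝ) →L[ℝ] V} (hΘ : IsSkew Θ) :
    Function.Bijective (restrict Θ) := by
  have hs : Function.Surjective (restrict Θ) := by
    rintro ⟨w, ξ, rfl⟩
    refine ⟨ξ ∘L (im Θ).subtypeL, Subtype.ext ?_⟩
    exact restrict_eq hΘ _ ξ fun w => rfl
  refine ⟨?_, hs⟩
  rw [injective_iff_map_eq_zero]
  intro η hη
  ext w
  obtain ⟨η', rfl⟩ := hs w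
  have h := hΘ (η ∘L proj (im Θ)) (η' ∘L proj (im Θ))
  have h1 : (restrict Θ η : V) = 0 := by rw [hη]; rfl
  have h2 : proj (im Θ) (restrict Θ η' : V) = restrict Θ η' := proj_apply _ _
  change (η' ∘L proj (im Θ)) (restrict Θ η : V) = -(η (proj (im Θ) (restrict Θ η' : V))) at h
  rw [h1, h2, map_zero] at h
  simpa using h.symm

/-- The inverse of the restriction of a bivector `Θ` to `W = Im Θ`: the bilinear form `ζ` on `W`
with `ζ(w, w') = η w'`, where `η ∈ W*` is the unique functional that the restriction of `Θ`
sends to `w`. -/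
def inverseForm (Θ : (V →L[ℝ] ℝ) →L[ℝ] V) (hΘ : IsSkew Θ) (w w' : im Θ) : ℝ :=
  (LinearEquiv.ofBijective (restrict Θ) (restrict_bijective hΘ)).symm w w'

theorem inverseForm_apply {Θ : (V →L[ℝ] ℝ) →L[ℝ] V} (hΘ : IsSkew Θ) (ξ : V →L[ℝ] ℝ)
    (w w' : im Θ) (hw : Θ ξ = w) : inverseForm Θ hΘ w w' = ξ w' := by
  have h : restrict Θ (ξ ∘L (im Θ).subtypeL) = w :=
    Subtype.ext ((restrict_eq hΘ _ ξ fun w => rfl).trans hw)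
  have : (LinearEquiv.ofBijective (restrict Θ) (restrict_bijective hΘ)).symm w
      = ξ ∘L (im Θ).subtypeL := by
    rw [LinearEquiv.symm_apply_eq]
    exact h.symm
  rw [inverseForm, this]
  rfl

theorem inverseForm_self {Θ : (V →L[ℝ] ℝ) →L[ℝ] V} (hΘ : IsSkew Θ) (w : im Θ) :
    inverseForm Θ hΘ w w = 0 := by
  obtain ⟨w, ξ, rfl⟩ := w
  rw [inverseForm_apply hΘ ξ _ _ rfl]
  have := hΘ ξ ξ
  change ξ (Θ ξ) = 0
  linarith

/-- For a linear map `A : F → V` with values in `W = Im Θ`, the linear map `F → F*` sending `u` to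
`ζ(A u, A ·)`, with `ζ` the inverse of the restriction of `Θ` to `W`. -/
def pullbackMap {F : Type*} [NormedAddCommGroup F] [NormedSpace ℝ F]
    (Θ : (V →L[ℝ] ℝ) →L[ℝ] V) (hΘ : IsSkew Θ) (A : F →L[ℝ] V) (hA : ∀ u, A u ∈ im Θ) :
    F →ₗ[ℝ] F →L[ℝ] ℝ where
  toFun u := (LinearEquiv.ofBijective (restrict Θ) (restrict_bijective hΘ)).symm ⟨A u, hA u⟩ ∘L
    A.codRestrict (im Θ) hA
  map_add' u v := by
    have : (⟨A (u + v), hA (u + v)⟩ : im Θ) = ⟨A u, hA u⟩ + ⟨A v, hA v⟩ :=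
      Subtype.ext (map_add A u v)
    rw [this, map_add, ContinuousLinearMap.add_comp]
  map_smul' c u := by
    have : (⟨A (c • u), hA (c • u)⟩ : im Θ) = c • ⟨A u, hA u⟩ :=
      Subtype.ext (map_smul A c u)
    rw [this, map_smul, ContinuousLinearMap.smul_comp, RingHom.id_apply]

/-- The pullback `(u, v) ↦ ζ(A u, A v)` of the inverse `ζ` of the restriction of `Θ` to `W = Im Θ`
under a linear map `A : F → V` with values in `W`, as an alternating 2-form on `F`. -/
def pullbackInverse {F : Type*} [NormedAddCommGroup F] [NormedSpace ℝ F] [FiniteDimensional ℝ F]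
    (Θ : (V →L[ℝ] ℝ) →L[ℝ] V) (hΘ : IsSkew Θ) (A : F →L[ℝ] V) (hA : ∀ u, A u ∈ im Θ) :
    F [⋀^Fin 2]→L[ℝ] ℝ where
  toFun u := inverseForm Θ hΘ ⟨A (u 0), hA (u 0)⟩ ⟨A (u 1), hA (u 1)⟩
  map_update_add' {_} u i x y := by
    change pullbackMap Θ hΘ A hA _ _ = pullbackMap Θ hΘ A hA _ _ + pullbackMap Θ hΘ A hA _ _
    fin_cases i <;> simp
  map_update_smul' {_} u i c x := by
    change pullbackMap Θ hΘ A hA _ _ = c • pullbackMap Θ hΘ A hA _ _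
    fin_cases i <;> simp
  cont := by
    change Continuous fun u : Fin 2 → F =>
      LinearMap.toContinuousLinearMap (pullbackMap Θ hΘ A hA) (u 0) (u 1)
    fun_prop
  map_eq_zero_of_eq' u i j h hij := by
    have h01 : u 0 = u 1 := by fin_cases i <;> fin_cases j <;> simp_all
    simp only [h01]
    exact inverseForm_self hΘ _

end LinearAlgebra

section Manifold

variable {E : Type*} [NormedAddCommGroup E] [NormedSpace ℝ E]
  {M : Type*} [TopologicalSpace M] [ChartedSpace E M]

instance (x : M) : T2Space (TangentSpace 𝓘(ℝ, E) x) := inferInstanceAs (T2Space E)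

instance [FiniteDimensional ℝ E] (x : M) : FiniteDimensional ℝ (TangentSpace 𝓘(ℝ, E) x) :=
  inferInstanceAs (FiniteDimensional ℝ E)

/-- A parametrized connected integral manifold of a distribution `D`: an injective smooth immersion
`f` into `M` of a nonempty connected open set `U ⊆ ℝᵏ`, whose tangent space at each point is the
fibre of `D`. -/
structure IsIntegralPatch (D : ∀ x : M, Submodule ℝ (TangentSpace 𝓘(ℝ, E) x)) {k : ℕ}
    (U : Set (EuclideanSpace ℝ (Fin k))) (f : EuclideanSpace ℝ (Fin k) → M) : Prop where
  isOpen : IsOpen U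
  isConnected : IsConnected U
  injOn : InjOn f U
  smooth : ContMDiffOn 𝓘(ℝ, EuclideanSpace ℝ (Fin k)) 𝓘(ℝ, E) ∞ f U
  immersion : ∀ p ∈ U,
    Function.Injective (mfderiv 𝓘(ℝ, EuclideanSpace ℝ (Fin k)) 𝓘(ℝ, E) f p)
  tangent : ∀ p ∈ U, ∀ v : TangentSpace 𝓘(ℝ, E) (f p),
    v ∈ D (f p) ↔ ∃ u, mfderiv 𝓘(ℝ, EuclideanSpace ℝ (Fin k)) 𝓘(ℝ, E) f p u = v

/-- A distribution is integrable if every point of `M` lies in an integral manifold. -/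
def IsIntegrableDistribution (D : ∀ x : M, Submodule ℝ (TangentSpace 𝓘(ℝ, E) x)) : Prop :=
  ∀ x : M, ∃ (k : ℕ) (U : Set (EuclideanSpace ℝ (Fin k))) (f : EuclideanSpace ℝ (Fin k) → M),
    IsIntegralPatch D U f ∧ x ∈ f '' U

/-- Two points lie in a common parametrized connected integral manifold of `D`. -/
def InCommonPatch (D : ∀ x : M, Submodule ℝ (TangentSpace 𝓘(ℝ, E) x)) (x y : M) : Prop :=
  ∃ (k : ℕ) (U : Set (EuclideanSpace ℝ (Fin k))) (f : EuclideanSpace ℝ (Fin k) → M),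
    IsIntegralPatch D U f ∧ x ∈ f '' U ∧ y ∈ f '' U

/-- The leaf through `x` of an integrable distribution `D`, that is, the maximal connected integral
manifold containing `x`: the set of all points which can be joined to `x` by a finite chain of
connected integral manifolds. Its manifold structure is the one for which the parametrized integral
manifolds contained in it are inverses of local coordinate systems. -/
def leaf (D : ∀ x : M, Submodule ℝ (TangentSpace 𝓘(ℝ, E) x)) (x : M) : Set M :=
  {y | Relation.ReflTransGen (InCommonPatch D) x y}

/-- A family of cotangent vectors is a smooth 1-form. -/
def IsSmoothOneForm [IsManifold 𝓘(ℝ, E) ∞ M]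
    (ξ : ∀ x : M, TangentSpace 𝓘(ℝ, E) x →L[ℝ] ℝ) : Prop :=
  ContMDiff 𝓘(ℝ, E) (𝓘(ℝ, E).prod 𝓘(ℝ, E →L[ℝ] ℝ)) ∞
    fun x => TotalSpace.mk' (E →L[ℝ] ℝ) (E := fun x : M => TangentSpace 𝓘(ℝ, E) x →L[ℝ] ℝ) x (ξ x)

theorem tensorialAt_dualDeriv [IsManifold 𝓘(ℝ, E) ∞ M]
    (cov : CovariantDerivative 𝓘(ℝ, E) E (TangentSpace 𝓘(ℝ, E) : M → Type _))
    {ξ : ∀ x : M, TangentSpace 𝓘(ℝ, E) x →L[ℝ] ℝ} (hξ : IsSmoothOneForm ξ) (x : M)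
    (v : TangentSpace 𝓘(ℝ, E) x) :
    TensorialAt 𝓘(ℝ, E) E (fun Y : ∀ x : M, TangentSpace 𝓘(ℝ, E) x =>
      mvfderiv 𝓘(ℝ, E) (fun y => ξ y (Y y)) x v - ξ x (cov Y x v)) x := by
  have key : ∀ Y : ∀ x : M, TangentSpace 𝓘(ℝ, E) x,
      MDifferentiableAt 𝓘(ℝ, E) 𝓘(ℝ, E).tangent (fun x => TotalSpace.mk' E x (Y x)) x →
      MDifferentiableAt 𝓘(ℝ, E) 𝓘(ℝ, ℝ) (fun y => ξ y (Y y)) x := by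
    intro Y hY
    have h := MDifferentiableAt.clm_bundle_apply (F₁ := E) (F₂ := ℝ)
      (E₁ := (TangentSpace 𝓘(ℝ, E) : M → Type _)) (E₂ := Bundle.Trivial M ℝ) (b := id)
      (ϕ := ξ) (v := Y) ((hξ x).mdifferentiableAt (by simp)) hY
    exact ((mdifferentiableAt_totalSpace _ _).1 h).2
  constructor
  · intro g Y hg hY
    have h1 := mvfderiv_fun_mul hg (key Y hY)
    have h2 := cov.isCovariantDerivativeOnUniv.leibniz hY hg
    simp only [Pi.smul_apply', map_smul, smul_eq_mul, h1, h2]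
    simp
    ring
  · intro Y Y' hY hY'
    have h1 := mvfderiv_fun_add (key Y hY) (key Y' hY')
    have h2 := cov.isCovariantDerivativeOnUniv.add hY hY'
    simp only [Pi.add_apply, map_add, h1, h2]
    simp
    ring

/-- The covariant derivative `∇_v ξ` of a smooth 1-form, in the connection on `T*M` induced by a
connection on `TM`: `(∇_v ξ) Y = d_v (ξ Y) - ξ (∇_v Y)`. -/
def dualDeriv [FiniteDimensional ℝ E] [IsManifold 𝓘(ℝ, E) ∞ M]
    (cov : CovariantDerivative 𝓘(ℝ, E) E (TangentSpace 𝓘(ℝ, E) : M → Type _))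
    (ξ : ∀ x : M, TangentSpace 𝓘(ℝ, E) x →L[ℝ] ℝ) (hξ : IsSmoothOneForm ξ) (x : M)
    (v : TangentSpace 𝓘(ℝ, E) x) : TangentSpace 𝓘(ℝ, E) x →L[ℝ] ℝ :=
  TensorialAt.mkHom _ x (tensorialAt_dualDeriv cov hξ x v)

variable (E M) in
/-- A (smooth) bivector field on `M`: a smooth skew-symmetric (2,0) tensor field, treated as a
vector-bundle morphism `T*M → TM`. -/
structure Bivector [IsManifold 𝓘(ℝ, E) ∞ M] where
  toFun : ∀ x : M, (TangentSpace 𝓘(ℝ, E) x →L[ℝ] ℝ) →L[ℝ] TangentSpace 𝓘(ℝ, E) x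
  smooth : ContMDiff 𝓘(ℝ, E) (𝓘(ℝ, E).prod 𝓘(ℝ, (E →L[ℝ] ℝ) →L[ℝ] E)) ∞
    fun x => TotalSpace.mk' ((E →L[ℝ] ℝ) →L[ℝ] E)
      (E := fun x : M => (TangentSpace 𝓘(ℝ, E) x →L[ℝ] ℝ) →L[ℝ] TangentSpace 𝓘(ℝ, E) x)
      x (toFun x)
  skew : ∀ x, IsSkew (toFun x)

namespace Bivector

variable [FiniteDimensional ℝ E] [IsManifold 𝓘(ℝ, E) ∞ M]

/-- The distribution `Im Θ`. -/
def image (Θ : Bivector E M) (x : M) : Submodule ℝ (TangentSpace 𝓘(ℝ, E) x) := im (Θ.toFun x)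

/-- `Θ` has constant rank. -/
def HasConstantRank (Θ : Bivector E M) : Prop :=
  ∃ r : ℕ, ∀ x, Module.finrank ℝ (Θ.image x) = r

/-- `Θ` is locally constant: around each point there are local coordinates in which the components
`Θ(dx^i, dx^j)` are constant. -/
def IsLocallyConstant (Θ : Bivector E M) : Prop :=
  ∀ x : M, ∃ φ ∈ IsManifold.maximalAtlas 𝓘(ℝ, E) ∞ M, x ∈ φ.source ∧
    ∃ B : (E →L[ℝ] ℝ) → (E →L[ℝ] ℝ) → ℝ, ∀ y ∈ φ.source, ∀ α β : E →L[ℝ] ℝ,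
      (β ∘L mvfderiv 𝓘(ℝ, E) φ y) (Θ.toFun y (α ∘L mvfderiv 𝓘(ℝ, E) φ y)) = B α β

/-- `Θ` is parallel, `∇Θ = 0`, that is, `∇_v (Θ ξ) = Θ (∇_v ξ)` for all 1-forms `ξ` and tangent
vectors `v`. -/
def IsParallel (Θ : Bivector E M)
    (cov : CovariantDerivative 𝓘(ℝ, E) E (TangentSpace 𝓘(ℝ, E) : M → Type _)) : Prop :=
  ∀ (ξ : ∀ x : M, TangentSpace 𝓘(ℝ, E) x →L[ℝ] ℝ) (hξ : IsSmoothOneForm ξ) (x : M)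
    (v : TangentSpace 𝓘(ℝ, E) x),
    cov (fun y => Θ.toFun y (ξ y)) x v = Θ.toFun x (dualDeriv cov ξ hξ x v)

/-- `Θ` is integrable: some smooth torsion-free connection on `M` makes it parallel. -/
def IsIntegrable (Θ : Bivector E M) : Prop :=
  ∃ cov : CovariantDerivative 𝓘(ℝ, E) E (TangentSpace 𝓘(ℝ, E) : M → Type _),
    cov.ContMDiffCovariantDerivative ∞ ∧ cov.torsion = 0 ∧ Θ.IsParallel cov

open scoped Classical in
/-- The pullback to `U`, under a parametrized integral manifold `f : U → M` of `Im Θ`, of the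
inverse of the restriction of `Θ` to `Im Θ` (set equal to `0` outside the open set `U`). This is the
restriction of that inverse to the integral manifold, in the local coordinates given by `f`. -/
def inverseOnPatch (Θ : Bivector E M) {k : ℕ} {U : Set (EuclideanSpace ℝ (Fin k))}
    {f : EuclideanSpace ℝ (Fin k) → M} (hf : IsIntegralPatch Θ.image U f)
    (p : EuclideanSpace ℝ (Fin k)) : EuclideanSpace ℝ (Fin k) [⋀^Fin 2]→L[ℝ] ℝ :=
  if hp : p ∈ U then
    pullbackInverse (Θ.toFun (f p)) (Θ.skew (f p))
      (mfderiv 𝓘(ℝ, EuclideanSpace ℝ (Fin k)) 𝓘(ℝ, E) f p ∘L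
        ((fromTangentSpace (𝕜 := ℝ) p).symm :
          EuclideanSpace ℝ (Fin k) →L[ℝ] TangentSpace 𝓘(ℝ, EuclideanSpace ℝ (Fin k)) p))
      (fun _ => (hf.tangent p hp _).2 ⟨_, rfl⟩)
  else 0

/-- The inverse of the restriction of `Θ` to `Im Θ` is closed along a leaf `L` of `Im Θ`: in the
local coordinates of `L`, this 2-form on `L` has zero exterior derivative. -/
def InverseClosedAlong (Θ : Bivector E M) (L : Set M) : Prop :=
  ∀ (k : ℕ) (U : Set (EuclideanSpace ℝ (Fin k))) (f : EuclideanSpace ℝ (Fin k) → M)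
    (hf : IsIntegralPatch Θ.image U f), f '' U ⊆ L →
    ∀ p ∈ U, extDeriv (Θ.inverseOnPatch hf) p = 0

end Bivector

end Manifold

end BivectorFields

end

noncomputable section

namespace BivectorFields
open Filter Topology

/-! The three conditions are linked through the Jacobi identity for the bracket {f, g} = Θ(df, dg).
For the components P of Θ in a chart it says that the cyclic sum β(DP(Pγ)α) + γ(DP(Pα)β) +
α(DP(Pβ)γ) vanishes (`JacobiAt`).

(b) implies Jacobi: parallelism expresses DP through the Christoffel symbols
(`fderiv_chartRep_of_isParallel`), and in the cyclic sum the six resulting terms cancel in pairs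
because a torsion-free connection has symmetric symbols (`jacobiAt_of_isParallel`). (c) implies
Jacobi: on an integral manifold of Im Θ, the value of dζ on the vectors Pγ, Pα, Pβ is exactly that
cyclic sum (`extDeriv_eq_jacobiator`, `jacobiAt_of_closed`).

Jacobi and constant rank r imply (a), by a Darboux argument (`exists_constant_coordinates`). If {f,
g} is constant, Jacobi makes the Hamiltonian fields of f and g commute (`hamiltonian_commute`).
Given k < r functions with constant mutual brackets and independent Hamiltonian fields, straighten
these fields simultaneously. A linear function of the straightening coordinates has constant
derivatives along them, hence constant brackets with the given functions, and its differential at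
the base point is arbitrary, so the family can be enlarged (`ConstantBrackets.exists_snoc`). For k =
r the fields span Im P, and the r functions together with the transversal straightening coordinates
form a chart in which P is constant. Straightening rests on a smooth joint flow of commuting fields
(`exists_flow`), obtained from the inverse function theorem in the Banach space of continuous
curves.

(a) implies (b): the flat connections of charts with constant components are glued by a partition of
unity; being torsion-free and making Θ parallel are affine conditions on the connection
(`isIntegrable_of_isLocallyConstant`). (a) implies (c): affine slices are integral manifolds, and DP
= 0 makes dζ vanish (`isIntegrableDistribution_of_isLocallyConstant`,
`inverseClosedAlong_of_isLocallyConstant`). -/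

/-- A smooth map with invertible derivative at a point is a local diffeomorphism there, with source
inside any prescribed neighbourhood. -/
theorem exists_localDiffeo {E F : Type*} [NormedAddCommGroup E] [NormedSpace ℝ E] [CompleteSpace E]
    [NormedAddCommGroup F] [NormedSpace ℝ F] {f : E → F} {a : E} {f' : E ≃L[ℝ] F}
    (hf : ∀ᶠ x in 𝓝 a, ContDiffAt ℝ ∞ f x) (hf' : HasFDerivAt f (f' : E →L[ℝ] F) a)
    {P : E → Prop} (hP : ∀ᶠ x in 𝓝 a, P x) :
    ∃ e : OpenPartialHomeomorph E F, a ∈ e.source ∧ (∀ x, e x = f x) ∧ (∀ x ∈ e.source, P x) ∧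
      (∀ x ∈ e.source, ContDiffAt ℝ ∞ e x) ∧ (∀ y ∈ e.target, ContDiffAt ℝ ∞ e.symm y) ∧
      ∀ x ∈ e.source, ∃ g : E ≃L[ℝ] F, HasFDerivAt e (g : E →L[ℝ] F) x := by
  have hcont : ContinuousAt (fderiv ℝ f) a := (hf.self_of_nhds.fderiv_right (m := 0) (by simp)).continuousAt
  have hinv : ∀ᶠ x in 𝓝 a, ∃ g : E ≃L[ℝ] F, (g : E →L[ℝ] F) = fderiv ℝ f x := by
    have := hcont.eventually (by rw [hf'.fderiv]; exact f'.nhds)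
    exact this
  set s := interior {x | P x ∧ ContDiffAt ℝ ∞ f x ∧ ∃ g : E ≃L[ℝ] F, (g : E →L[ℝ] F) = fderiv ℝ f x}
  have hs : a ∈ s := mem_interior_iff_mem_nhds.2 (hP.and (hf.and hinv))
  have hs' : ∀ x ∈ s, P x ∧ ContDiffAt ℝ ∞ f x ∧
    ∃ g : E ≃L[ℝ] F, (g : E →L[ℝ] F) = fderiv ℝ f x := fun x hx => interior_subset (s := {x | P x ∧ ContDiffAt ℝ ∞ f x ∧
      ∃ g : E ≃L[ℝ] F, (g : E →L[ℝ] F) = fderiv ℝ f x}) hx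
  let e₀ := hf.self_of_nhds.toOpenPartialHomeomorph f hf' (by simp)
  have he₀ : ∀ x, e₀ x = f x := fun x => rfl
  have ha₀ : a ∈ e₀.source := hf.self_of_nhds.mem_toOpenPartialHomeomorph_source hf' (by simp)
  have hsrc : (e₀.restr s).source = e₀.source ∩ s := by
    rw [OpenPartialHomeomorph.restr_source, isOpen_interior.interior_eq]
  have hD : ∀ x ∈ (e₀.restr s).source, ∃ g : E ≃L[ℝ] F,
      HasFDerivAt (e₀.restr s) (g : E →L[ℝ] F) x := by
    intro x hx
    rw [hsrc] at hx
    obtain ⟨-, hc, g, hg⟩ := hs' x hx.2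
    exact ⟨g, hg ▸ (hc.differentiableAt (by simp)).hasFDerivAt⟩
  have hC : ∀ x ∈ (e₀.restr s).source, ContDiffAt ℝ ∞ (e₀.restr s) x := by
    intro x hx
    rw [hsrc] at hx
    exact (hs' x hx.2).2.1
  refine ⟨e₀.restr s, by rw [hsrc]; exact ⟨ha₀, hs⟩, he₀, ?_, hC, ?_, hD⟩
  · intro x hx
    rw [hsrc] at hx
    exact (hs' x hx.2).1
  · intro y hy
    have hx := (e₀.restr s).map_target hy
    obtain ⟨g, hg⟩ := hD _ hx
    exact (e₀.restr s).contDiffAt_symm hy hg (hC _ hx)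

/-! ### Superposition operators on spaces of continuous maps. -/

section Superposition

variable {K : Type*} [TopologicalSpace K] [CompactSpace K]

/-- The superposition operator `γ ↦ X ∘ γ` on spaces of continuous maps. -/
def superposition {E F : Type*} [TopologicalSpace E] [TopologicalSpace F] (X : C(E, F))
    (γ : C(K, E)) : C(K, F) := X.comp γ

variable {E F : Type*} [NormedAddCommGroup E] [NormedSpace ℝ E]
  [NormedAddCommGroup F] [NormedSpace ℝ F]

instance : SeminormedAddCommGroup C(K, E →L[ℝ] F) := ContinuousMap.instSeminormedAddCommGroup

instance : NormedAddCommGroup C(K, E →L[ℝ] F) := ContinuousMap.instNormedAddCommGroup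

variable (K E F) in
/-- Pointwise application of a continuous family of continuous linear maps. -/
def pointwiseApply : C(K, E →L[ℝ] F) →L[ℝ] C(K, E) →L[ℝ] C(K, F) :=
  LinearMap.mkContinuous₂ (LinearMap.mk₂ ℝ
    (fun (A : C(K, E →L[ℝ] F)) (h : C(K, E)) => (⟨fun t => A t (h t), by fun_prop⟩ : C(K, F)))
    (fun _ _ _ => by ext; simp) (fun _ _ _ => by ext; simp)
    (fun _ _ _ => by ext; simp) (fun _ _ _ => by ext; simp)) 1 (by
      intro A h
      rw [ContinuousMap.norm_le _ (by positivity), one_mul]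
      intro t
      exact (A t).le_of_opNorm_le_of_le (A.norm_coe_le_norm t) (h.norm_coe_le_norm t))

@[simp] theorem pointwiseApply_apply (A : C(K, E →L[ℝ] F)) (h : C(K, E)) (t : K) :
    pointwiseApply K E F A h t = A t (h t) := rfl

/-- The range of γ is compact, so X' is uniformly continuous near it even when E is
infinite-dimensional; by the mean value inequality the first-order remainder of X is then small
uniformly in t. -/
theorem hasFDerivAt_superposition {X : C(E, F)} {X' : C(E, E →L[ℝ] F)}
    (hX : ∀ x, HasFDerivAt X (X' x) x) (γ : C(K, E)) :
    HasFDerivAt (superposition (K := K) X) (pointwiseApply K E F (superposition X' γ)) γ := by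
  rw [hasFDerivAt_iff_isLittleO_nhds_zero, Asymptotics.isLittleO_iff]
  intro ε hε
  have hcomp : IsCompact (range γ) := isCompact_range γ.continuous
  have h1 := hcomp.uniformContinuousAt_of_continuousAt X' (fun y _ => X'.continuous.continuousAt)
    (Metric.dist_mem_uniformity hε)
  obtain ⟨δ, hδ, h2⟩ := Metric.mem_uniformity_dist.1 h1
  filter_upwards [Metric.ball_mem_nhds (0 : C(K, E)) hδ] with h hh
  rw [ContinuousMap.norm_le _ (by positivity)]
  intro t
  have hht : ‖h t‖ < δ := (h.norm_coe_le_norm t).trans_lt (by simpa using hh)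
  have key := (convex_ball (γ t) δ).norm_image_sub_le_of_norm_hasFDerivWithin_le' (f := X)
    (f' := X') (φ := X' (γ t)) (C := ε) (x := γ t) (y := γ t + h t)
    (fun x _ => (hX x).hasFDerivWithinAt)
    (fun x hx => by
      have := h2 (a := γ t) (b := x) (by rw [dist_comm]; exact hx) (mem_range_self t)
      rw [← dist_eq_norm, dist_comm]
      exact le_of_lt this) (Metric.mem_ball_self hδ) (by simpa using hht)
  calc ‖(superposition X (γ + h) - superposition X γ -
        pointwiseApply K E F (superposition X' γ) h) t‖
      = ‖X (γ t + h t) - X (γ t) - X' (γ t) (γ t + h t - γ t)‖ := by simp [superposition]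
    _ ≤ ε * ‖γ t + h t - γ t‖ := key
    _ ≤ ε * ‖h‖ := by
        rw [add_sub_cancel_left]; gcongr; exact h.norm_coe_le_norm t

-- The derivative at γ is pointwise application of the superposition operator of DX, so smoothness
-- climbs by induction. The target F varies in the induction, since DX takes values in E →L F; a
-- common universe keeps that space within the range of the quantifier.
universe u in
theorem contDiff_superposition_nat {E : Type u} [NormedAddCommGroup E] [NormedSpace ℝ E] (n : ℕ) :
    ∀ {F : Type u} [NormedAddCommGroup F] [NormedSpace ℝ F] (X : C(E, F)),
      ContDiff ℝ ∞ X → ContDiff ℝ n (superposition (K := K) X) := by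
  induction n with
  | zero =>
    intro F _ _ X _
    exact contDiff_zero.2 (ContinuousMap.continuous_postcomp X)
  | succ n ih =>
    intro F _ _ X hX
    have hX' : ContDiff ℝ ∞ (fderiv ℝ X) := hX.fderiv_right (by simp)
    let X' : C(E, E →L[ℝ] F) := ⟨fderiv ℝ X, hX'.continuous⟩
    have hd : ∀ γ : C(K, E), HasFDerivAt (superposition (K := K) X)
        (pointwiseApply K E F (superposition X' γ)) γ :=
      hasFDerivAt_superposition fun x => (hX.differentiable (by simp) x).hasFDerivAt
    have heq : fderiv ℝ (superposition (K := K) X) =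
        fun γ => pointwiseApply K E F (superposition X' γ) := funext fun γ => (hd γ).fderiv
    rw [Nat.cast_add, Nat.cast_one, contDiff_succ_iff_fderiv]
    refine ⟨fun γ => (hd γ).differentiableAt, fun h => absurd h (by simp), ?_⟩
    rw [heq]
    exact (pointwiseApply K E F).contDiff.comp (ih X' hX')

universe u in
theorem contDiff_superposition {E F : Type u} [NormedAddCommGroup E] [NormedSpace ℝ E]
    [NormedAddCommGroup F] [NormedSpace ℝ F] {X : C(E, F)}
    (hX : ContDiff ℝ ∞ X) : ContDiff ℝ ∞ (superposition (K := K) X) :=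
  contDiff_infty.2 fun n => contDiff_superposition_nat n X hX

end Superposition

/-! ### The integration operator on curves. -/

section Integral
theorem continuous_extend {E : Type*} [TopologicalSpace E] (γ : C(unitInterval, E)) :
    Continuous fun σ : ℝ => γ (projIcc 0 1 zero_le_one σ) :=
  γ.continuous.comp continuous_projIcc

variable {E : Type*} [NormedAddCommGroup E] [NormedSpace ℝ E]

theorem norm_primitive_le (γ : C(unitInterval, E)) (τ : unitInterval) :
    ‖∫ σ in (0 : ℝ)..τ, γ (projIcc 0 1 zero_le_one σ)‖ ≤ ‖γ‖ := by
  refine (intervalIntegral.norm_integral_le_of_norm_le_const (C := ‖γ‖)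
    fun σ _ => γ.norm_coe_le_norm _).trans ?_
  rw [sub_zero, abs_of_nonneg τ.2.1]
  exact mul_le_of_le_one_right (norm_nonneg _) τ.2.2

variable (E) in
/-- The operator sending `γ` to its primitive vanishing at `0`. -/
def primitive [CompleteSpace E] : C(unitInterval, E) →L[ℝ] C(unitInterval, E) :=
  LinearMap.mkContinuous
    { toFun := fun γ => ⟨fun τ => ∫ σ in (0 : ℝ)..τ, γ (projIcc 0 1 zero_le_one σ),
        (intervalIntegral.continuous_primitive
          (fun _ _ => (continuous_extend γ).intervalIntegrable _ _) 0).comp continuous_subtype_val⟩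
      map_add' := fun γ γ' => by
        ext τ
        exact intervalIntegral.integral_add ((continuous_extend γ).intervalIntegrable _ _)
          ((continuous_extend γ').intervalIntegrable _ _)
      map_smul' := fun c γ => by
        ext τ
        exact intervalIntegral.integral_smul _ _ }
    1 (fun γ => by
      rw [one_mul, ContinuousMap.norm_le _ (norm_nonneg _)]
      exact norm_primitive_le γ)

theorem primitive_apply [CompleteSpace E] (γ : C(unitInterval, E)) (τ : unitInterval) :
    primitive E γ τ = ∫ σ in (0 : ℝ)..τ, γ (projIcc 0 1 zero_le_one σ) := rfl

end Integral

/-! ### Joint flows of commuting vector fields and simultaneous straightening. -/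

variable {E : Type*} [NormedAddCommGroup E] [NormedSpace ℝ E]

/-- Along an integral curve `γ` of `∑ tⱼ Xⱼ`, the field `τ ↦ τ Xᵢ(γ τ)` solves the linearized
equation when the `Xⱼ` commute. -/
theorem primitive_linearized [CompleteSpace E] {ι : Type*} [Fintype ι] {X : ι → C(E, E)}
    {X' : ι → C(E, E →L[ℝ] E)} (hX : ∀ i x, HasFDerivAt (X i) (X' i x) x) {γ : C(unitInterval, E)} {s : E}
    {t : ι → ℝ} (hγ : ∀ τ, γ τ = s + primitive E (∑ j, t j • superposition (X j) γ) τ)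
    (hcomm : ∀ τ i j, X' j (γ τ) (X i (γ τ)) = X' i (γ τ) (X j (γ τ))) (i : ι) {h : C(unitInterval, E)}
    (hh : ∀ τ, h τ = (τ : ℝ) • X i (γ τ)) :
    h = primitive E (superposition (X i) γ +
      ∑ j, t j • pointwiseApply unitInterval E E (superposition (X' j) γ) h) := by
  set p : ℝ → unitInterval := projIcc 0 1 zero_le_one
  let u : C(unitInterval, E) := ∑ j, t j • superposition (X j) γ
  have hu : ∀ τ, u τ = ∑ j, t j • X j (γ τ) := by
    intro τ; simp [u, superposition]
  -- The integral equation extends γ to a curve differentiable on the whole line, so the endpoints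
  -- of the unit interval need no one-sided derivatives.
  let c : ℝ → E := fun τ => s + ∫ σ in (0 : ℝ)..τ, u (p σ)
  have hcd : ∀ τ, HasDerivAt c (u (p τ)) τ := fun τ =>
    ((continuous_extend u).integral_hasStrictDerivAt 0 τ).hasDerivAt.const_add s
  have hc : ∀ τ : ℝ, τ ∈ unitInterval → c τ = γ (p τ) := by
    intro τ hτ
    have hp : p τ = ⟨τ, hτ⟩ := projIcc_of_mem _ hτ
    rw [hp, hγ]; rfl
  ext τ
  rw [primitive_apply, hh]
  -- The product rule gives Xᵢ + σ ∑ tⱼ Xᵢ'(Xⱼ); commutation replaces Xᵢ'(Xⱼ) by Xⱼ'(Xᵢ), which is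
  -- the integrand of the linearized equation.
  have hk : ∀ σ ∈ uIcc (0 : ℝ) τ, HasDerivAt (fun σ => σ • X i (c σ))
      ((superposition (X i) γ +
        ∑ j, t j • pointwiseApply unitInterval E E (superposition (X' j) γ) h) (p σ)) σ := by
    intro σ hσ
    rw [uIcc_of_le τ.2.1] at hσ
    have hσI : σ ∈ unitInterval := ⟨hσ.1, hσ.2.trans τ.2.2⟩
    have hpσ : ((p σ : unitInterval) : ℝ) = σ := by
      rw [show p σ = ⟨σ, hσI⟩ from projIcc_of_mem _ hσI]
    have := (hasDerivAt_id σ).smul ((hX i (c σ)).comp_hasDerivAt σ (hcd σ))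
    refine this.congr_deriv ?_
    simp only [hc σ hσI, hu, map_sum, map_smul, ContinuousMap.add_apply, ContinuousMap.coe_sum,
      Finset.sum_apply, ContinuousMap.coe_smul, Pi.smul_apply, pointwiseApply_apply, superposition,
      ContinuousMap.comp_apply, hh, hpσ, id, one_smul, Finset.smul_sum, hcomm, Function.comp_apply]
    rw [add_comm]
    congr 1
    exact Finset.sum_congr rfl fun j _ => smul_comm _ _ _
  rw [intervalIntegral.integral_eq_sub_of_hasDerivAt hk
    ((continuous_extend _).intervalIntegrable _ _)]
  have : p τ = τ := projIcc_val _ τ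
  simp [hc τ τ.2, this]

/-- Φ(t, s) is the value at time 1 of the integral curve of ∑ tⱼ Xⱼ that starts at s. The curve is a
zero of a smooth map G on a Banach space, so it depends smoothly on (t, s). Its derivative in tᵢ
solves the linearized equation; since the fields commute, τ Xᵢ(γ τ) is that solution, and at τ = 1
it gives Xᵢ(Φ). -/
theorem exists_flow_of_contDiff [CompleteSpace E] {ι : Type*} [Fintype ι] [DecidableEq ι]
    {X : ι → C(E, E)} (hX : ∀ i, ContDiff ℝ ∞ (X i)) {x₀ : E}
    (hcomm : ∀ᶠ x in 𝓝 x₀, ∀ i j, fderiv ℝ (X j) x (X i x) = fderiv ℝ (X i) x (X j x)) :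
    ∃ Φ : (ι → ℝ) × E → E, (∀ᶠ v in 𝓝 (0, x₀), ContDiffAt ℝ ∞ Φ v) ∧
      (∀ᶠ s in 𝓝 x₀, Φ (0, s) = s) ∧
      ∀ᶠ v in 𝓝 (0, x₀), ∀ i, fderiv ℝ Φ v (Pi.single i 1, 0) = X i (Φ v) := by
  let X' : ι → C(E, E →L[ℝ] E) := fun i =>
    ⟨fderiv ℝ (X i), ((hX i).fderiv_right (m := ∞) (by simp)).continuous⟩
  have hX' : ∀ i x, HasFDerivAt (X i) (X' i x) x := fun i x =>
    ((hX i).differentiable (by simp) x).hasFDerivAt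
  let cst : E →L[ℝ] C(unitInterval, E) := LinearMap.mkContinuous
    { toFun := fun x => ContinuousMap.const unitInterval x
      map_add' := fun _ _ => rfl
      map_smul' := fun _ _ => rfl } 1 (fun x => by
        rw [one_mul, ContinuousMap.norm_le _ (norm_nonneg _)]
        exact fun _ => le_rfl)
  have hcst : ∀ x τ, cst x τ = x := fun _ _ => rfl
  let G : ((ι → ℝ) × E) × C(unitInterval, E) → C(unitInterval, E) := fun w =>
    w.2 - cst w.1.2 - primitive E (∑ j, w.1.1 j • superposition (X j) w.2)
  have hNs : ∀ j, ContDiff ℝ ∞ (superposition (K := unitInterval) (X j)) := fun j =>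
    contDiff_superposition (hX j)
  have hGs : ContDiff ℝ ∞ G := by
    refine (contDiff_snd.sub (cst.contDiff.comp (contDiff_snd.comp contDiff_fst))).sub
      ((primitive E).contDiff.comp (ContDiff.sum fun j _ => ?_))
    have h1 : ContDiff ℝ ∞ fun w : ((ι → ℝ) × E) × C(unitInterval, E) => w.1.1 j :=
      (contDiff_apply ℝ ℝ j).comp (contDiff_fst.comp contDiff_fst)
    exact h1.smul ((hNs j).comp contDiff_snd)
  let D : ((ι → ℝ) × E) → C(unitInterval, E) → ((ι → ℝ) × E) × C(unitInterval, E) →L[ℝ] C(unitInterval, E) := fun v γ =>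
    ContinuousLinearMap.snd ℝ _ _ -
      cst ∘L ContinuousLinearMap.snd ℝ _ _ ∘L ContinuousLinearMap.fst ℝ _ _ -
      primitive E ∘L (∑ j, (v.1 j • (pointwiseApply unitInterval E E (superposition (X' j) γ) ∘L
        ContinuousLinearMap.snd ℝ _ _) +
        (ContinuousLinearMap.proj j ∘L ContinuousLinearMap.fst ℝ _ _ ∘L
          ContinuousLinearMap.fst ℝ _ _).smulRight (superposition (X j) γ)))
  have hG : ∀ v γ, HasFDerivAt G (D v γ) (v, γ) := by
    intro v γ
    refine HasFDerivAt.sub (HasFDerivAt.sub hasFDerivAt_snd ?_) ?_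
    · exact cst.hasFDerivAt.comp (v, γ) (hasFDerivAt_snd.comp (v, γ) hasFDerivAt_fst)
    · refine (primitive E).hasFDerivAt.comp _ (HasFDerivAt.fun_sum fun j _ => ?_)
      have h1 : HasFDerivAt (fun w : ((ι → ℝ) × E) × C(unitInterval, E) => w.1.1 j)
          (ContinuousLinearMap.proj j ∘L ContinuousLinearMap.fst ℝ _ _ ∘L
          ContinuousLinearMap.fst ℝ _ _) (v, γ) :=
        ContinuousLinearMap.hasFDerivAt (ContinuousLinearMap.proj (R := ℝ) (φ := fun _ : ι => ℝ) j ∘L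
          ContinuousLinearMap.fst ℝ (ι → ℝ) E ∘L
          ContinuousLinearMap.fst ℝ ((ι → ℝ) × E) C(unitInterval, E))
      have h2 : HasFDerivAt (fun w : ((ι → ℝ) × E) × C(unitInterval, E) => superposition (X j) w.2)
          (pointwiseApply unitInterval E E (superposition (X' j) γ) ∘L ContinuousLinearMap.snd ℝ _ _) (v, γ) :=
        (hasFDerivAt_superposition (hX' j) γ).comp (v, γ) hasFDerivAt_snd
      exact h1.smul h2
  let v₀ : (ι → ℝ) × E := (0, x₀)
  let γ₀ : C(unitInterval, E) := cst x₀
  have hG₀ : G (v₀, γ₀) = 0 := by simp [G, v₀, γ₀]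
  let Ψ : ((ι → ℝ) × E) × C(unitInterval, E) → ((ι → ℝ) × E) × C(unitInterval, E) := fun w => (w.1, G w)
  have hΨ : ∀ v γ, HasFDerivAt Ψ ((ContinuousLinearMap.fst ℝ _ _).prod (D v γ)) (v, γ) :=
    fun v γ => hasFDerivAt_fst.prodMk (hG v γ)
  -- At t = 0 the integral term does not vary with the curve, so the derivative of G in the curve is
  -- the identity and that of Ψ is an invertible shear.
  let g₀ : (((ι → ℝ) × E) × C(unitInterval, E)) ≃L[ℝ] (((ι → ℝ) × E) × C(unitInterval, E)) :=
    (ContinuousLinearEquiv.refl ℝ _).skewProd (ContinuousLinearEquiv.refl ℝ _)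
      (D v₀ γ₀ ∘L ContinuousLinearMap.inl ℝ _ _)
  have hΨ₀ : HasFDerivAt Ψ (g₀ : _ →L[ℝ] _) (v₀, γ₀) := by
    refine (hΨ v₀ γ₀).congr_fderiv ?_
    refine ContinuousLinearMap.ext fun w => Prod.ext ?_ ?_
    · simp [g₀]
    · simp only [g₀, ContinuousLinearEquiv.coe_coe, ContinuousLinearEquiv.skewProd_apply]
      simp [D, v₀]
      abel
  obtain ⟨O, hOc, hO, hx₀O⟩ := eventually_nhds_iff.1 hcomm
  -- Commutation is known only on O, and it is needed along the entire curve, not just at its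
  -- endpoint.
  have hP : ∀ᶠ w in 𝓝 (v₀, γ₀), ∀ τ, (w.2 : C(unitInterval, E)) τ ∈ O := by
    obtain ⟨δ, hδ, hball⟩ := Metric.isOpen_iff.1 hO x₀ hx₀O
    have : ∀ᶠ γ in 𝓝 γ₀, ∀ τ, (γ : C(unitInterval, E)) τ ∈ O := by
      filter_upwards [Metric.ball_mem_nhds γ₀ hδ] with γ hγ τ
      exact hball ((ContinuousMap.dist_apply_le_dist τ).trans_lt hγ)
    exact (continuous_snd.tendsto (v₀, γ₀)).eventually this
  obtain ⟨e, he₀, heΨ, heP, heC, heS, heD⟩ := exists_localDiffeo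
    (Eventually.of_forall fun w => (contDiff_fst.prodMk hGs).contDiffAt) hΨ₀ hP
  have hec : (e : _ → _) = Ψ := funext heΨ
  -- Ψ keeps the parameter v, so its inverse on the slice (v, 0) selects the solution of G(v, ·) =
  -- 0.
  let Γ : (ι → ℝ) × E → C(unitInterval, E) := fun v => (e.symm (v, 0)).2
  have htgt : ∀ᶠ v in 𝓝 v₀, (v, (0 : C(unitInterval, E))) ∈ e.target := by
    have h0 : (v₀, (0 : C(unitInterval, E))) ∈ e.target := by
      have := e.map_source he₀
      rw [heΨ] at this
      change (v₀, G (v₀, γ₀)) ∈ e.target at this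
      rwa [hG₀] at this
    have hc : Continuous fun v : (ι → ℝ) × E => (v, (0 : C(unitInterval, E))) := by fun_prop
    exact hc.continuousAt.eventually (e.open_target.mem_nhds h0)
  have hsymm : ∀ v, (v, (0 : C(unitInterval, E))) ∈ e.target → e.symm (v, 0) = (v, Γ v) ∧ G (v, Γ v) = 0 := by
    intro v hv
    have h1 := e.right_inv hv
    rw [heΨ] at h1
    have h2 : e.symm (v, 0) = (v, Γ v) := Prod.ext (congrArg (fun w : _ × _ => w.1) h1 :) rfl
    refine ⟨h2, ?_⟩
    rw [h2] at h1
    exact congrArg Prod.snd h1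
  have hΓs : ∀ v, (v, (0 : C(unitInterval, E))) ∈ e.target → ContDiffAt ℝ ∞ Γ v := fun v hv =>
    contDiffAt_snd.comp v ((heS _ hv).comp v (f := fun v => (v, (0 : C(unitInterval, E))))
      (contDiffAt_id.prodMk contDiffAt_const))
  let ev : C(unitInterval, E) →L[ℝ] E := ContinuousMap.evalCLM ℝ (1 : unitInterval)
  have hev : ∀ γ : C(unitInterval, E), ev γ = γ 1 := fun _ => rfl
  refine ⟨fun v => ev (Γ v), htgt.mono fun v hv => ev.contDiff.contDiffAt.comp v (hΓs v hv), ?_, ?_⟩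
  · have hc : Continuous fun s : E => ((0 : ι → ℝ), s) := by fun_prop
    filter_upwards [hc.continuousAt.eventually htgt] with s hs
    have := congrArg (fun γ : C(unitInterval, E) => γ 1) (hsymm _ hs).2
    simp only [G, Pi.zero_apply, zero_smul, Finset.sum_const_zero, map_zero, sub_zero,
      ContinuousMap.sub_apply, hcst, ContinuousMap.zero_apply] at this
    exact sub_eq_zero.1 this
  · filter_upwards [htgt, htgt.eventually_nhds] with v hv hv' i
    obtain ⟨h1, h2⟩ := hsymm v hv
    have hsrc : (v, Γ v) ∈ e.source := h1 ▸ e.map_target hv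
    obtain ⟨g, hg⟩ := heD _ hsrc
    have hgD : (g : _ →L[ℝ] _) = (ContinuousLinearMap.fst ℝ _ _).prod (D v (Γ v)) :=
      hg.unique (hec ▸ hΨ v (Γ v))
    have hΓd : HasFDerivAt Γ (fderiv ℝ Γ v) v :=
      ((hΓs v hv).differentiableAt (by simp)).hasFDerivAt
    have hcomp : HasFDerivAt (fun w => e (w, Γ w))
        ((g : _ →L[ℝ] _) ∘L (ContinuousLinearMap.id ℝ _).prod (fderiv ℝ Γ v)) v :=
      hg.comp v ((hasFDerivAt_id v).prodMk hΓd)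
    have hconst : HasFDerivAt (fun w => e (w, Γ w))
        ((ContinuousLinearMap.id ℝ _).prod 0) v := by
      refine HasFDerivAt.congr_of_eventuallyEq
        ((hasFDerivAt_id v).prodMk (hasFDerivAt_const (0 : C(unitInterval, E)) v)) ?_
      filter_upwards [hv'] with w hw
      rw [heΨ]
      exact Prod.ext rfl (hsymm w hw).2
    let h : C(unitInterval, E) := ⟨fun τ => (τ : ℝ) • X i (Γ v τ), by fun_prop⟩
    have hlin : h = primitive E (superposition (X i) (Γ v) +
        ∑ j, v.1 j • pointwiseApply unitInterval E E (superposition (X' j) (Γ v)) h) := by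
      refine primitive_linearized hX' (s := v.2) (fun τ => ?_)
        (fun τ i j => hOc _ (heP _ hsrc τ) i j) i fun τ => rfl
      have := congrArg (fun γ : C(unitInterval, E) => γ τ) h2
      simp only [G, ContinuousMap.sub_apply, hcst, ContinuousMap.zero_apply] at this
      rw [sub_sub] at this
      exact sub_eq_zero.1 this
    -- Both h and ∂Γ/∂tᵢ complete the i-th time direction to a vector that the derivative of Ψ sends
    -- to the same image. Invertibility of g identifies them, so no separate uniqueness theorem for
    -- the linear equation is needed.
    have hgh : g ((Pi.single i 1, 0), h) = ((Pi.single i 1, 0), 0) := by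
      rw [← ContinuousLinearEquiv.coe_coe, hgD]
      refine Prod.ext rfl ?_
      change D v (Γ v) ((Pi.single i 1, 0), h) = 0
      have : ∑ j, (Pi.single i (1 : ℝ) : ι → ℝ) j • superposition (X j) (Γ v) =
          superposition (X i) (Γ v) := by
        rw [Finset.sum_eq_single i] <;> simp +contextual
      simp only [D, sub_apply, ContinuousLinearMap.comp_apply,
        ContinuousLinearMap.coe_snd', ContinuousLinearMap.coe_fst', map_zero, sub_zero,
        sum_apply, add_apply,
        smul_apply, ContinuousLinearMap.smulRight_apply,
        ContinuousLinearMap.proj_apply, Finset.sum_add_distrib, this]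
      rw [add_comm, ← hlin, sub_self]
    have hΓi : fderiv ℝ Γ v (Pi.single i 1, 0) = h := by
      have h3 := congrArg (fun L : _ →L[ℝ] _ => L (Pi.single i 1, 0)) (hcomp.unique hconst)
      have h4 : g ((Pi.single i 1, 0), fderiv ℝ Γ v (Pi.single i 1, 0)) =
          ((Pi.single i 1, 0), 0) := h3
      exact congrArg Prod.snd (g.injective (h4.trans hgh.symm))
    have : HasFDerivAt (fun v => ev (Γ v)) (ev ∘L fderiv ℝ Γ v) v := ev.hasFDerivAt.comp v hΓd
    rw [this.fderiv, ContinuousLinearMap.comp_apply, hΓi, hev, hev]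
    change ((1 : unitInterval) : ℝ) • X i (Γ v 1) = _
    simp

variable {E : Type*} [NormedAddCommGroup E] [NormedSpace ℝ E] [FiniteDimensional ℝ E]

/-- A map which is smooth near a point agrees near that point with a smooth map. -/
theorem exists_contDiff_eventuallyEq {F : Type*} [NormedAddCommGroup F] [NormedSpace ℝ F]
    {X : E → F} {x₀ : E} (hX : ∀ᶠ x in 𝓝 x₀, ContDiffAt ℝ ∞ X x) :
    ∃ Y : C(E, F), ContDiff ℝ ∞ Y ∧ ∀ᶠ x in 𝓝 x₀, Y x = X x := by
  obtain ⟨r, hr, hball⟩ := Metric.eventually_nhds_iff_ball.1 hX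
  let f : ContDiffBump x₀ := ⟨r / 3, r / 2, by positivity, by linarith⟩
  have hs : ContDiff ℝ ∞ fun x => f x • X x := by
    rw [contDiff_iff_contDiffAt]
    intro x
    by_cases hx : x ∈ Metric.ball x₀ r
    · exact f.contDiff.contDiffAt.smul (hball x hx)
    · have : x ∉ tsupport f := by
        rw [f.tsupport_eq]
        simp only [Metric.mem_ball, Metric.mem_closedBall, not_lt, not_le, f] at hx ⊢
        linarith
      refine contDiffAt_const (c := (0 : F)) |>.congr_of_eventuallyEq ?_
      filter_upwards [(isClosed_tsupport f).isOpen_compl.mem_nhds this] with y hy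
      rw [image_eq_zero_of_notMem_tsupport hy, zero_smul]
  refine ⟨⟨_, hs.continuous⟩, hs, ?_⟩
  filter_upwards [Metric.closedBall_mem_nhds x₀ f.rIn_pos] with x hx
  simp [f.one_of_mem_closedBall hx]

/-- The joint flow of commuting smooth vector fields. -/
theorem exists_flow {ι : Type*} [Fintype ι] [DecidableEq ι] {X : ι → E → E} {x₀ : E}
    (hX : ∀ i, ∀ᶠ x in 𝓝 x₀, ContDiffAt ℝ ∞ (X i) x)
    (hcomm : ∀ᶠ x in 𝓝 x₀, ∀ i j, fderiv ℝ (X j) x (X i x) = fderiv ℝ (X i) x (X j x)) :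
    ∃ Φ : (ι → ℝ) × E → E, (∀ᶠ v in 𝓝 (0, x₀), ContDiffAt ℝ ∞ Φ v) ∧
      (∀ᶠ s in 𝓝 x₀, Φ (0, s) = s) ∧
      ∀ᶠ v in 𝓝 (0, x₀), ∀ i, fderiv ℝ Φ v (Pi.single i 1, 0) = X i (Φ v) := by
  -- The superposition operators require globally smooth fields; cutting off preserves the germs at
  -- x₀, hence commutation near x₀.
  choose Y hYs hYX using fun i => exists_contDiff_eventuallyEq (hX i)
  have hYX' : ∀ᶠ x in 𝓝 x₀, ∀ i, Y i =ᶠ[𝓝 x] X i :=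
    eventually_all.2 fun i => (hYX i).eventually_nhds
  obtain ⟨Φ, h1, h2, h3⟩ := exists_flow_of_contDiff hYs (x₀ := x₀) (by
    filter_upwards [hYX', hcomm] with x hx hc i j
    rw [(hx i).fderiv_eq, (hx j).fderiv_eq, (hx i).eq_of_nhds, (hx j).eq_of_nhds]
    exact hc i j)
  refine ⟨Φ, h1, h2, ?_⟩
  have hΦ : Tendsto Φ (𝓝 (0, x₀)) (𝓝 x₀) := by
    have := h1.self_of_nhds.continuousAt
    rwa [ContinuousAt, h2.self_of_nhds] at this
  filter_upwards [h3, hΦ.eventually hYX'] with v hv hv' i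
  rw [hv, (hv' i).eq_of_nhds]

/-- Commuting vector fields which are linearly independent at a point can be straightened. -/
theorem exists_straightening {ι : Type*} [Fintype ι] [DecidableEq ι] {X : ι → E → E} {x₀ : E}
    (hX : ∀ i, ∀ᶠ x in 𝓝 x₀, ContDiffAt ℝ ∞ (X i) x)
    (hcomm : ∀ᶠ x in 𝓝 x₀, ∀ i j, fderiv ℝ (X j) x (X i x) = fderiv ℝ (X i) x (X j x))
    (hind : LinearIndependent ℝ fun i => X i x₀) :
    ∃ (F : Submodule ℝ E) (e : OpenPartialHomeomorph E ((ι → ℝ) × F)), x₀ ∈ e.source ∧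
      (∀ x ∈ e.source, ContDiffAt ℝ ∞ e x) ∧
      (∀ x ∈ e.source, ∃ g : E ≃L[ℝ] (ι → ℝ) × F,
        HasFDerivAt e (g : E →L[ℝ] (ι → ℝ) × F) x) ∧
      ∀ x ∈ e.source, ∀ i, fderiv ℝ e x (X i x) = (Pi.single i 1, 0) := by
  obtain ⟨Φ, h1, h2, h3⟩ := exists_flow hX hcomm
  obtain ⟨F, hF⟩ := (Submodule.span ℝ (range fun i => X i x₀)).exists_isCompl
  -- Flow out from the affine slice x₀ + F transversal to the fields. At the origin the derivative
  -- sends time directions to the Xᵢ x₀ and is the inclusion on F, hence is bijective; the inverse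
  -- map straightens the fields.
  let inc : (ι → ℝ) × F → (ι → ℝ) × E := fun v => (v.1, x₀ + v.2)
  have hinc : ∀ v, HasFDerivAt inc
      ((ContinuousLinearMap.id ℝ (ι → ℝ)).prodMap F.subtypeL) v := by
    intro v
    exact hasFDerivAt_fst.prodMk
      ((F.subtypeL.hasFDerivAt.comp v hasFDerivAt_snd).const_add x₀)
  have hincs : ContDiff ℝ ∞ inc :=
    contDiff_fst.prodMk (contDiff_const.add (F.subtypeL.contDiff.comp contDiff_snd))
  have hinc0 : inc 0 = (0, x₀) := by simp [inc]
  have hinct : Tendsto inc (𝓝 0) (𝓝 (0, x₀)) := by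
    have := hincs.continuous.tendsto 0
    rwa [hinc0] at this
  have hΨs : ∀ᶠ v in 𝓝 0, ContDiffAt ℝ ∞ (Φ ∘ inc) v :=
    (hinct.eventually h1).mono fun v hv => hv.comp v hincs.contDiffAt
  have hΨd : ∀ v, ContDiffAt ℝ ∞ Φ (inc v) → HasFDerivAt (Φ ∘ inc)
      (fderiv ℝ Φ (inc v) ∘L (ContinuousLinearMap.id ℝ (ι → ℝ)).prodMap F.subtypeL) v :=
    fun v hv => (hv.differentiableAt (by simp)).hasFDerivAt.comp v (hinc v)
  have hΨX : ∀ᶠ v in 𝓝 0, ∀ i, fderiv ℝ (Φ ∘ inc) v (Pi.single i 1, 0) = X i (Φ (inc v)) := by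
    filter_upwards [hinct.eventually h1, hinct.eventually h3] with v hv hv3 i
    rw [(hΨd v hv).fderiv, ← hv3 i]
    simp
  have hΦ0 : Φ (inc 0) = x₀ := by rw [hinc0]; exact h2.self_of_nhds
  set L := fderiv ℝ (Φ ∘ inc) 0
  have hLt : ∀ i, L (Pi.single i 1, 0) = X i x₀ := fun i => by
    rw [← hΦ0]; exact hΨX.self_of_nhds i
  have hLs : ∀ z : F, L (0, z) = z := by
    intro z
    have hc : HasFDerivAt (fun s : E => Φ (0, s)) (fderiv ℝ Φ (0, x₀) ∘L
        ContinuousLinearMap.inr ℝ (ι → ℝ) E) x₀ :=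
      (h1.self_of_nhds.differentiableAt (by simp)).hasFDerivAt.comp x₀
        (hasFDerivAt_prodMk_right 0 x₀)
    have h4 := hc.unique ((hasFDerivAt_id x₀).congr_of_eventuallyEq h2)
    have h5 : fderiv ℝ Φ (0, x₀) (0, (z : E)) = z :=
      congrArg (fun A : E →L[ℝ] E => A z) h4
    have h6 : L = _ := (hΨd 0 (by rw [hinc0]; exact h1.self_of_nhds)).fderiv
    rw [h6, hinc0]
    simpa using h5
  have hL : ∀ v, L v = ∑ i, v.1 i • X i x₀ + v.2 := by
    intro v
    have hv : v = ∑ i, v.1 i • ((Pi.single i 1 : ι → ℝ), (0 : F)) + (0, v.2) := by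
      refine Prod.ext ?_ ?_
      · simp only [Prod.fst_add, Prod.fst_sum, Prod.smul_fst, add_zero]
        exact (pi_eq_sum_univ' v.1)
      · simp [Prod.snd_sum]
    conv_lhs => rw [hv]
    simp only [map_add, map_sum, map_smul, hLt, hLs]
  have hLbij : Function.Bijective L := by
    have hspan : ∀ t : ι → ℝ, ∑ i, t i • X i x₀ ∈ Submodule.span ℝ (range fun i => X i x₀) :=
      fun t => Submodule.sum_mem _ fun i _ =>
        Submodule.smul_mem _ _ (Submodule.subset_span (mem_range_self i))
    constructor
    · rw [injective_iff_map_eq_zero]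
      intro v hv
      rw [hL] at hv
      have h7 : ∑ i, v.1 i • X i x₀ = -(v.2 : E) := eq_neg_of_add_eq_zero_left hv
      have h8 : ∑ i, v.1 i • X i x₀ = 0 := (Submodule.disjoint_def.1 hF.disjoint) _ (hspan _)
        (h7 ▸ F.neg_mem v.2.2)
      refine Prod.ext (funext fun i => Fintype.linearIndependent_iff.1 hind _ h8 i) ?_
      rw [h8, zero_add] at hv
      exact Subtype.ext hv
    · intro x
      have hx : x ∈ Submodule.span ℝ (range fun i => X i x₀) ⊔ F := by
        rw [hF.sup_eq_top]; trivial
      obtain ⟨y, hy, z, hz, rfl⟩ := Submodule.mem_sup.1 hx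
      obtain ⟨t, rfl⟩ := (Submodule.mem_span_range_iff_exists_fun ℝ).1 hy
      exact ⟨(t, ⟨z, hz⟩), hL _⟩
  let g₀ : ((ι → ℝ) × F) ≃L[ℝ] E :=
    (LinearEquiv.ofBijective (L : _ →ₗ[ℝ] _) hLbij).toContinuousLinearEquiv
  have hg₀ : HasFDerivAt (Φ ∘ inc) (g₀ : _ →L[ℝ] E) 0 :=
    ((hΨs.self_of_nhds.differentiableAt (by simp)).hasFDerivAt).congr_fderiv
      (ContinuousLinearMap.ext fun v => rfl)
  obtain ⟨e, he₀, heΨ, heP, -, heS, heD⟩ := exists_localDiffeo hΨs hg₀ hΨX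
  have hec : (e : _ → _) = Φ ∘ inc := funext heΨ
  have hsD : ∀ x ∈ e.target, ∃ g : ((ι → ℝ) × F) ≃L[ℝ] E,
      HasFDerivAt e (g : _ →L[ℝ] E) (e.symm x) ∧
      HasFDerivAt e.symm (g.symm : E →L[ℝ] _) x := by
    intro x hx
    obtain ⟨g, hg⟩ := heD _ (e.map_target hx)
    exact ⟨g, hg, e.hasFDerivAt_symm hx hg⟩
  refine ⟨F, e.symm, ?_, heS, ?_, ?_⟩
  · have := e.map_source he₀
    rwa [heΨ, Function.comp_apply, hΦ0] at this
  · intro x hx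
    obtain ⟨g, -, hg⟩ := hsD x hx
    exact ⟨g.symm, hg⟩
  · intro x hx i
    obtain ⟨g, hg, hgs⟩ := hsD x hx
    rw [hgs.fderiv]
    change g.symm (X i x) = _
    rw [ContinuousLinearEquiv.symm_apply_eq]
    have h9 := heP _ (e.map_target hx) i
    rw [← Function.comp_apply (f := Φ), ← heΨ, e.right_inv hx, ← hec, hg.fderiv] at h9
    exact h9.symm

/-! ### The Jacobi identity and Hamiltonian vector fields. -/

variable {E : Type*} [NormedAddCommGroup E] [NormedSpace ℝ E]

theorem two_le_infty : (2 : WithTop ℕ∞) ≤ ∞ := by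
  exact WithTop.coe_le_coe.2 (le_top (a := (2 : ℕ∞)))

/-- The Jacobi identity at `x` for the bracket defined by a bivector field `P` on a vector space. -/
def JacobiAt (P : E → (E →L[ℝ] ℝ) →L[ℝ] E) (x : E) : Prop :=
  ∀ α β γ : E →L[ℝ] ℝ, β (fderiv ℝ P x (P x γ) α) + γ (fderiv ℝ P x (P x α) β) +
    α (fderiv ℝ P x (P x β) γ) = 0

/-- The Hamiltonian vector field of `f`. -/
def hamiltonian (P : E → (E →L[ℝ] ℝ) →L[ℝ] E) (f : E → ℝ) (x : E) : E := P x (fderiv ℝ f x)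

/-- Skewness is a linear condition, so it survives differentiation. -/
theorem fderiv_skew {P : E → (E →L[ℝ] ℝ) →L[ℝ] E} {x : E} (hP : DifferentiableAt ℝ P x)
    (hs : ∀ᶠ y in 𝓝 x, IsSkew (P y)) (v : E) : IsSkew (fderiv ℝ P x v) := by
  intro ξ η
  have h : ∀ ξ η : E →L[ℝ] ℝ,
      HasFDerivAt (fun y => η (P y ξ)) (η ∘L (fderiv ℝ P x).flip ξ) x := by
    intro ξ η
    refine η.hasFDerivAt.comp x ?_
    refine (hP.hasFDerivAt.clm_apply (hasFDerivAt_const ξ x)).congr_fderiv ?_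
    simp
  have h2 := (h ξ η).unique ((h η ξ).neg.congr_of_eventuallyEq (hs.mono fun y hy => hy ξ η))
  exact congrArg (fun L : E →L[ℝ] ℝ => L v) h2

theorem contDiffAt_hamiltonian {P : E → (E →L[ℝ] ℝ) →L[ℝ] E} {f : E → ℝ} {x : E}
    (hP : ContDiffAt ℝ ∞ P x) (hf : ContDiffAt ℝ ∞ f x) :
    ContDiffAt ℝ ∞ (hamiltonian P f) x :=
  hP.clm_apply (hf.fderiv_right (by simp))

theorem fderiv_hamiltonian {P : E → (E →L[ℝ] ℝ) →L[ℝ] E} {f : E → ℝ} {x : E}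
    (hP : ContDiffAt ℝ ∞ P x) (hf : ContDiffAt ℝ ∞ f x) (v : E) :
    fderiv ℝ (hamiltonian P f) x v =
      fderiv ℝ P x v (fderiv ℝ f x) + P x (fderiv ℝ (fderiv ℝ f) x v) := by
  have h := (hP.differentiableAt (by simp)).hasFDerivAt.clm_apply
    ((hf.fderiv_right (m := ∞) (by simp)).differentiableAt (by simp)).hasFDerivAt
  have h2 : HasFDerivAt (hamiltonian P f) _ x := h
  rw [h2.fderiv]
  simp [add_comm]

variable [FiniteDimensional ℝ E]

/-- Hamiltonian vector fields of functions with constant bracket commute. -/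
theorem hamiltonian_commute {P : E → (E →L[ℝ] ℝ) →L[ℝ] E} {f g : E → ℝ} {x : E}
    (hP : ContDiffAt ℝ ∞ P x) (hs : ∀ᶠ y in 𝓝 x, IsSkew (P y)) (hJ : JacobiAt P x)
    (hf : ContDiffAt ℝ ∞ f x) (hg : ContDiffAt ℝ ∞ g x) {c : ℝ}
    (hc : ∀ᶠ y in 𝓝 x, fderiv ℝ g y (hamiltonian P f y) = c) :
    fderiv ℝ (hamiltonian P g) x (hamiltonian P f x) =
      fderiv ℝ (hamiltonian P f) x (hamiltonian P g x) := by
  have hsx : IsSkew (P x) := hs.self_of_nhds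
  rw [← sub_eq_zero]
  refine (Module.forall_dual_apply_eq_zero_iff ℝ _).1 fun φ => ?_
  set γ : E →L[ℝ] ℝ := LinearMap.toContinuousLinearMap φ
  change γ (_ - _) = 0
  -- Differentiating the constant bracket dg(P df) along Pγ produces two Hessian terms and dg(DP(Pγ)
  -- df). The Jacobi identity expresses the latter by the DP terms of the commutator paired with γ;
  -- `e1` and `e2` match the Hessian terms, using skewness of P and symmetry of second derivatives.
  have hd : fderiv ℝ (fderiv ℝ g) x (P x γ) (hamiltonian P f x) +
      fderiv ℝ g x (fderiv ℝ (hamiltonian P f) x (P x γ)) = 0 := by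
    have h1 := ((hg.fderiv_right (m := ∞) (by simp)).differentiableAt (by simp)).hasFDerivAt.clm_apply
      ((contDiffAt_hamiltonian hP hf).differentiableAt (by simp)).hasFDerivAt
    have h2 := h1.unique ((hasFDerivAt_const c x).congr_of_eventuallyEq hc)
    have h3 := congrArg (fun L : E →L[ℝ] ℝ => L (P x γ)) h2
    simpa [add_comm] using h3
  rw [fderiv_hamiltonian hP hf, map_add] at hd
  have hsym : ∀ {f : E → ℝ}, ContDiffAt ℝ ∞ f x → ∀ v w,
      fderiv ℝ (fderiv ℝ f) x v w = fderiv ℝ (fderiv ℝ f) x w v := fun hf v w =>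
    hf.isSymmSndFDerivAt (by simpa using two_le_infty) v w
  have hJ' := hJ (fderiv ℝ f x) (fderiv ℝ g x) γ
  have hsk := fderiv_skew (hP.differentiableAt (by simp)) hs
  rw [fderiv_hamiltonian hP hf, fderiv_hamiltonian hP hg, map_sub, map_add, map_add]
  have e1 : fderiv ℝ (fderiv ℝ g) x (P x γ) (hamiltonian P f x) =
      -γ (P x (fderiv ℝ (fderiv ℝ g) x (hamiltonian P f x))) := by
    rw [hsym hg, hsx]
  have e2 : fderiv ℝ g x (P x (fderiv ℝ (fderiv ℝ f) x (P x γ))) =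
      γ (P x (fderiv ℝ (fderiv ℝ f) x (hamiltonian P g x))) := by
    rw [hsx, hsx _ γ, hsym hf]; rfl
  have e3 := hsk (P x (fderiv ℝ g x)) γ (fderiv ℝ f x)
  rw [e1, e2] at hd
  rw [e3] at hJ'
  change _ + γ (fderiv ℝ P x (hamiltonian P f x) _) + -γ (fderiv ℝ P x (hamiltonian P g x) _) = 0
    at hJ'
  linarith


/-! ### Darboux coordinates for a Poisson bivector of constant rank. -/

/-- Functions with constant brackets and linearly independent Hamiltonian vector fields. -/
structure ConstantBrackets (P : E → (E →L[ℝ] ℝ) →L[ℝ] E) (x₀ : E) {k : ℕ} (f : Fin k → E → ℝ) :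
    Prop where
  smooth : ∀ i, ∀ᶠ x in 𝓝 x₀, ContDiffAt ℝ ∞ (f i) x
  bracket : ∀ i j, ∃ c : ℝ, ∀ᶠ x in 𝓝 x₀, fderiv ℝ (f j) x (hamiltonian P (f i) x) = c
  independent : LinearIndependent ℝ fun i => hamiltonian P (f i) x₀

section Darboux

variable {P : E → (E →L[ℝ] ℝ) →L[ℝ] E} {x₀ : E}

/-- Coordinates straightening the Hamiltonian vector fields of a family with constant brackets. -/
theorem ConstantBrackets.exists_straightening {k : ℕ} {f : Fin k → E → ℝ}
    (hf : ConstantBrackets P x₀ f)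
    (hP : ∀ᶠ x in 𝓝 x₀, ContDiffAt ℝ ∞ P x) (hs : ∀ᶠ x in 𝓝 x₀, IsSkew (P x))
    (hJ : ∀ᶠ x in 𝓝 x₀, JacobiAt P x) :
    ∃ (F : Submodule ℝ E) (e : OpenPartialHomeomorph E ((Fin k → ℝ) × F)), x₀ ∈ e.source ∧
      (∀ x ∈ e.source, ContDiffAt ℝ ∞ e x) ∧
      (∀ x ∈ e.source, ∃ g : E ≃L[ℝ] (Fin k → ℝ) × F,
        HasFDerivAt e (g : E →L[ℝ] (Fin k → ℝ) × F) x) ∧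
      ∀ x ∈ e.source, ∀ i, fderiv ℝ e x (hamiltonian P (f i) x) = (Pi.single i 1, 0) := by
  refine BivectorFields.exists_straightening (fun i => ?_) ?_ hf.independent
  · filter_upwards [hP, hf.smooth i] with x h1 h2
    exact contDiffAt_hamiltonian h1 h2
  · choose c hc using hf.bracket
    filter_upwards [hP, hs.eventually_nhds, hJ, eventually_all.2 hf.smooth,
      eventually_all.2 fun i => eventually_all.2 fun j => (hc i j).eventually_nhds]
      with x h1 h2 h3 h4 h5 i j
    exact hamiltonian_commute h1 h2 h3 (h4 i) (h4 j) (h5 i j)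

/-- In straightening coordinates a linear function h has constant derivative along each given
Hamiltonian field, so its brackets with the family are constant. Choosing dh at x₀ to be a covector
that P x₀ sends outside the span of the fields keeps independence. -/
theorem ConstantBrackets.exists_snoc {k : ℕ} {f : Fin k → E → ℝ}
    (hf : ConstantBrackets P x₀ f)
    (hP : ∀ᶠ x in 𝓝 x₀, ContDiffAt ℝ ∞ P x) (hs : ∀ᶠ x in 𝓝 x₀, IsSkew (P x))
    (hJ : ∀ᶠ x in 𝓝 x₀, JacobiAt P x) (hk : k < Module.finrank ℝ (im (P x₀))) :
    ∃ f' : Fin (k + 1) → E → ℝ, ConstantBrackets P x₀ f' := by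
  obtain ⟨F, e, hx₀, hes, hed, heX⟩ := hf.exists_straightening hP hs hJ
  have hsrc := e.open_source.mem_nhds hx₀
  obtain ⟨ξ, hξ⟩ : ∃ ξ, P x₀ ξ ∉ Submodule.span ℝ (range fun i => hamiltonian P (f i) x₀) := by
    by_contra! h
    have hle : im (P x₀) ≤ Submodule.span ℝ (range fun i => hamiltonian P (f i) x₀) := by
      rintro _ ⟨ξ, rfl⟩
      exact h ξ
    have := Submodule.finrank_mono hle
    rw [finrank_span_eq_card hf.independent, Fintype.card_fin] at this
    omega
  obtain ⟨g, hg⟩ := hed x₀ hx₀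
  -- This is ξ transported to the straightened model, so that h = l ∘ e has differential ξ at x₀.
  let l : (Fin k → ℝ) × F →L[ℝ] ℝ := ξ ∘L (g.symm : _ →L[ℝ] E)
  let h : E → ℝ := fun x => l (e x)
  have hd : ∀ x ∈ e.source, fderiv ℝ h x = l ∘L fderiv ℝ e x := fun x hx =>
    (l.hasFDerivAt.comp x ((hes x hx).differentiableAt (by simp)).hasFDerivAt).fderiv
  have hh₀ : hamiltonian P h x₀ = P x₀ ξ := by
    rw [hamiltonian, hd x₀ hx₀, hg.fderiv]
    congr 1
    ext v
    simp [l]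
  have hfh : ∀ i, ∀ᶠ x in 𝓝 x₀, fderiv ℝ h x (hamiltonian P (f i) x) = l (Pi.single i 1, 0) := by
    intro i
    filter_upwards [hsrc] with x hx
    rw [hd x hx, ContinuousLinearMap.comp_apply, heX x hx]
  have hskew : ∀ {a b : E → ℝ} {c : ℝ}, (∀ᶠ x in 𝓝 x₀, fderiv ℝ b x (hamiltonian P a x) = c) →
      ∀ᶠ x in 𝓝 x₀, fderiv ℝ a x (hamiltonian P b x) = -c := by
    intro a b c hab
    filter_upwards [hab, hs] with x h1 h2
    rw [← h1]
    exact h2 _ _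
  refine ⟨Fin.snoc (α := fun _ => E → ℝ) f h, ?_, ?_, ?_⟩
  · refine Fin.lastCases ?_ fun i => ?_
    · simp only [Fin.snoc_last]
      filter_upwards [hsrc] with x hx
      exact l.contDiff.contDiffAt.comp x (hes x hx)
    · simpa only [Fin.snoc_castSucc] using hf.smooth i
  · refine Fin.lastCases ?_ fun i => ?_ <;> refine Fin.lastCases ?_ fun j => ?_ <;>
      simp only [Fin.snoc_last, Fin.snoc_castSucc]
    · refine ⟨0, hs.mono fun x hx => ?_⟩
      have : fderiv ℝ h x (hamiltonian P h x) = -fderiv ℝ h x (hamiltonian P h x) := hx _ _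
      linarith
    · exact ⟨_, hskew (hfh j)⟩
    · exact ⟨_, hfh i⟩
    · exact hf.bracket i j
  · have : (fun i => hamiltonian P (Fin.snoc (α := fun _ => E → ℝ) f h i) x₀) =
        Fin.snoc (α := fun _ => E) (fun i => hamiltonian P (f i) x₀) (P x₀ ξ) := by
      funext i
      refine Fin.lastCases ?_ (fun i => ?_) i
      · simp [hh₀]
      · simp
    rw [this]
    exact linearIndependent_finSnoc.2 ⟨hf.independent, hξ⟩

theorem exists_constantBrackets
    (hP : ∀ᶠ x in 𝓝 x₀, ContDiffAt ℝ ∞ P x) (hs : ∀ᶠ x in 𝓝 x₀, IsSkew (P x))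
    (hJ : ∀ᶠ x in 𝓝 x₀, JacobiAt P x) (k : ℕ) (hk : k ≤ Module.finrank ℝ (im (P x₀))) :
    ∃ f : Fin k → E → ℝ, ConstantBrackets P x₀ f := by
  induction k with
  | zero => exact ⟨Fin.elim0, fun i => i.elim0, fun i => i.elim0, linearIndependent_empty_type⟩
  | succ k ih =>
    obtain ⟨f, hf⟩ := ih (by omega)
    exact hf.exists_snoc hP hs hJ (by omega)

/-- The Darboux theorem for Poisson bivector fields of constant rank. -/
theorem exists_constant_coordinates {r : ℕ}
    (hP : ∀ᶠ x in 𝓝 x₀, ContDiffAt ℝ ∞ P x) (hs : ∀ᶠ x in 𝓝 x₀, IsSkew (P x))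
    (hJ : ∀ᶠ x in 𝓝 x₀, JacobiAt P x)
    (hr : ∀ᶠ x in 𝓝 x₀, Module.finrank ℝ (im (P x)) = r)
    {Q : E → Prop} (hQ : ∀ᶠ x in 𝓝 x₀, Q x) :
    ∃ (ψ : OpenPartialHomeomorph E E) (C : (E →L[ℝ] ℝ) → E), x₀ ∈ ψ.source ∧
      (∀ x ∈ ψ.source, Q x) ∧ (∀ x ∈ ψ.source, ContDiffAt ℝ ∞ ψ x) ∧
      (∀ y ∈ ψ.target, ContDiffAt ℝ ∞ ψ.symm y) ∧
      ∀ x ∈ ψ.source, ∀ α, fderiv ℝ ψ x (P x (α ∘L fderiv ℝ ψ x)) = C α := by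
  obtain ⟨f, hf⟩ := exists_constantBrackets hP hs hJ r hr.self_of_nhds.ge
  obtain ⟨F, e, hx₀, hes, hed, heX⟩ := hf.exists_straightening hP hs hJ
  have hsrc := e.open_source.mem_nhds hx₀
  choose c hc using hf.bracket
  -- Independence is an open condition, and r independent vectors in a space of dimension r span it.
  -- Constant rank enters here.
  have hspan : ∀ᶠ x in 𝓝 x₀, im (P x) = Submodule.span ℝ (range fun i => hamiltonian P (f i) x) := by
    have hcont : ContinuousAt (fun x i => hamiltonian P (f i) x) x₀ :=
      continuousAt_pi.2 fun i =>
        (contDiffAt_hamiltonian hP.self_of_nhds (hf.smooth i).self_of_nhds).continuousAt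
    filter_upwards [hcont.eventually (isOpen_setOfPred_linearIndependent.mem_nhds hf.independent), hr]
      with x h1 h2
    have h1' : LinearIndependent ℝ fun i => hamiltonian P (f i) x := h1
    refine (Submodule.eq_of_le_of_finrank_eq ?_ ?_).symm
    · rw [Submodule.span_le]
      rintro _ ⟨i, rfl⟩
      exact ⟨_, rfl⟩
    · rw [finrank_span_eq_card h1', Fintype.card_fin, h2]
  -- The first r straightening coordinates are replaced by the functions fᵢ; the transversal ones
  -- are kept, since they are constant along all the Hamiltonian fields.
  let y : E → (Fin r → ℝ) × F := fun x => (fun i => f i x, (e x).2)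
  let Dy : E → E →L[ℝ] (Fin r → ℝ) × F := fun x =>
    (ContinuousLinearMap.pi fun i => fderiv ℝ (f i) x).prod
      (ContinuousLinearMap.snd ℝ _ _ ∘L fderiv ℝ e x)
  have hgood : ∀ᶠ x in 𝓝 x₀, x ∈ e.source ∧ (∀ i, ContDiffAt ℝ ∞ (f i) x) ∧ IsSkew (P x) ∧
      im (P x) = Submodule.span ℝ (range fun i => hamiltonian P (f i) x) ∧
      ∀ i j, fderiv ℝ (f j) x (hamiltonian P (f i) x) = c i j := by
    filter_upwards [hsrc, eventually_all.2 hf.smooth, hs, hspan,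
      eventually_all.2 fun i => eventually_all.2 fun j => hc i j] with x h1 h2 h3 h4 h5
    exact ⟨h1, h2, h3, h4, h5⟩
  have hys : ∀ᶠ x in 𝓝 x₀, ContDiffAt ℝ ∞ y x := hgood.mono fun x hx =>
    (contDiffAt_pi.2 hx.2.1).prodMk (contDiffAt_snd.comp x (hes x hx.1))
  have hyd : ∀ᶠ x in 𝓝 x₀, HasFDerivAt y (Dy x) x := hgood.mono fun x hx =>
    (hasFDerivAt_pi.2 fun i => ((hx.2.1 i).differentiableAt (by simp)).hasFDerivAt).prodMk
      (hasFDerivAt_snd.comp x ((hes x hx.1).differentiableAt (by simp)).hasFDerivAt)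
  have hDyX : ∀ᶠ x in 𝓝 x₀, ∀ i, Dy x (hamiltonian P (f i) x) = (c i, 0) := by
    filter_upwards [hgood] with x hx i
    refine Prod.ext (funext fun j => hx.2.2.2.2 i j) ?_
    simp [Dy, heX x hx.1]
  have hbr : ∀ᶠ x in 𝓝 x₀, ∀ l : (Fin r → ℝ) × F →L[ℝ] ℝ,
      Dy x (P x (l ∘L Dy x)) = ∑ i, l (Pi.single i 1, 0) • (c i, 0) := by
    filter_upwards [hgood, hDyX] with x hx h6 l
    obtain ⟨h1, -, h3, h4, -⟩ := hx
    set m : E →L[ℝ] ℝ := l ∘L ContinuousLinearMap.inr ℝ _ _ ∘L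
      ContinuousLinearMap.snd ℝ _ _ ∘L fderiv ℝ e x
    have hm : ∀ i, m (hamiltonian P (f i) x) = 0 := by
      intro i
      simp only [m, ContinuousLinearMap.comp_apply, heX x h1]
      exact map_zero l
    -- The pulled-back covector splits into a combination of the dfᵢ and a part m from the
    -- transversal coordinates. Since m kills every Hamiltonian field, P m has no component along
    -- the fⱼ by skewness, and none along F because it lies in the span of those fields.
    have hl : l ∘L Dy x = ∑ i, l (Pi.single i 1, 0) • fderiv ℝ (f i) x + m := by
      ext v
      have hv : Dy x v = ∑ i, fderiv ℝ (f i) x v • ((Pi.single i 1 : Fin r → ℝ), (0 : F)) +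
          (0, (fderiv ℝ e x v).2) := by
        refine Prod.ext ?_ ?_
        · simp only [Prod.fst_add, Prod.fst_sum, Prod.smul_fst, add_zero]
          exact pi_eq_sum_univ' (Dy x v).1
        · simp [Prod.snd_sum, Dy]
      rw [ContinuousLinearMap.comp_apply, hv, map_add, map_sum]
      simp only [map_smul, smul_eq_mul, add_apply, sum_apply, smul_apply]
      exact congrArg (· + _) (Finset.sum_congr rfl fun i _ => mul_comm _ _)
    have hPm : Dy x (P x m) = 0 := by
      have hmem : P x m ∈ im (P x) := ⟨m, rfl⟩
      refine Prod.ext (funext fun j => ?_) ?_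
      · change fderiv ℝ (f j) x (P x m) = 0
        rw [h3]
        exact neg_eq_zero.2 (hm j)
      · change (fderiv ℝ e x (P x m)).2 = 0
        rw [h4] at hmem
        obtain ⟨t, ht⟩ := (Submodule.mem_span_range_iff_exists_fun ℝ).1 hmem
        rw [← ht]
        simp [heX x h1, Prod.snd_sum]
    rw [hl, map_add, map_add, hPm, add_zero, map_sum, map_sum]
    refine Finset.sum_congr rfl fun i _ => ?_
    rw [map_smul, map_smul]
    exact congrArg _ (h6 i)
  -- A kernel vector has no transversal component, so it is tangent to the Hamiltonian fields and
  -- equals P ξ. Vanishing of the dfᵢ on it means that ξ kills Im P, and hence P ξ = 0.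
  have hinj : Function.Injective (Dy x₀) := by
    obtain ⟨h1, -, h3, h4, -⟩ := hgood.self_of_nhds
    rw [injective_iff_map_eq_zero]
    intro v hv
    obtain ⟨g, hg⟩ := hed x₀ h1
    have hv1 : ∀ i, fderiv ℝ (f i) x₀ v = 0 := fun i => congrFun (congrArg Prod.fst hv) i
    have hv2 : (fderiv ℝ e x₀ v).2 = 0 := congrArg Prod.snd hv
    have hv3 : v = ∑ i, (fderiv ℝ e x₀ v).1 i • hamiltonian P (f i) x₀ := by
      have hgi : Function.Injective (fderiv ℝ e x₀) := by rw [hg.fderiv]; exact g.injective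
      apply hgi
      rw [map_sum]
      simp only [map_smul, heX x₀ h1]
      refine Prod.ext ?_ ?_
      · rw [Prod.fst_sum]
        exact pi_eq_sum_univ' _
      · simpa [Prod.snd_sum] using hv2
    have hvm : v ∈ im (P x₀) := by
      rw [h4, hv3]
      exact Submodule.sum_mem _ fun i _ =>
        Submodule.smul_mem _ _ (Submodule.subset_span (mem_range_self i))
    obtain ⟨ξ, rfl⟩ := hvm
    have hξ : ∀ w ∈ im (P x₀), ξ w = (0 : E →L[ℝ] ℝ) w := by
      intro w hw
      rw [h4] at hw
      obtain ⟨t, rfl⟩ := (Submodule.mem_span_range_iff_exists_fun ℝ).1 hw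
      rw [map_sum]
      refine Finset.sum_eq_zero fun i _ => ?_
      have : ξ (hamiltonian P (f i) x₀) = -fderiv ℝ (f i) x₀ (P x₀ ξ) := h3 _ _
      rw [map_smul, this]
      simpa using Or.inr (hv1 i)
    exact (map_eq_of_eqOn h3 hξ).trans (map_zero _)
  -- Here g serves only as some linear identification of the model with E, so that the new chart
  -- takes values in E.
  obtain ⟨g, -⟩ := hed x₀ hx₀
  let A : E →L[ℝ] E := (g.symm : _ →L[ℝ] E) ∘L Dy x₀
  have hA : Function.Injective A := g.symm.injective.comp hinj
  let A' : E ≃L[ℝ] E := (LinearEquiv.ofInjectiveEndo (A : E →ₗ[ℝ] E) hA).toContinuousLinearEquiv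
  have hcs : ∀ᶠ x in 𝓝 x₀, ContDiffAt ℝ ∞ (fun x => g.symm (y x)) x :=
    hys.mono fun x hx => g.symm.contDiff.contDiffAt.comp x hx
  have hcd : ∀ᶠ x in 𝓝 x₀, HasFDerivAt (fun x => g.symm (y x))
      ((g.symm : _ →L[ℝ] E) ∘L Dy x) x :=
    hyd.mono fun x hx => g.symm.hasFDerivAt.comp x hx
  have hA₀ : HasFDerivAt (fun x => g.symm (y x)) (A' : E →L[ℝ] E) x₀ :=
    hcd.self_of_nhds.congr_fderiv (ContinuousLinearMap.ext fun v => rfl)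
  obtain ⟨ψ, hψ₀, hψ, hψP, hψs, hψs', -⟩ := exists_localDiffeo hcs hA₀ (hQ.and (hcd.and hbr))
  refine ⟨ψ, fun α => g.symm (∑ i, (α ∘L (g.symm : (Fin r → ℝ) × F →L[ℝ] E)) (Pi.single i 1, 0) •
    ((c i, 0) : (Fin r → ℝ) × F)),
    hψ₀, fun x hx => (hψP x hx).1, hψs, hψs', fun x hx α => ?_⟩
  obtain ⟨-, h2, h3⟩ := hψP x hx
  rw [funext hψ, h2.fderiv]
  exact congrArg g.symm (h3 (α ∘L (g.symm : (Fin r → ℝ) × F →L[ℝ] E)))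

end Darboux

theorem hasFDerivAt_apply_const {N G H : Type*} [NormedAddCommGroup N] [NormedSpace ℝ N]
    [NormedAddCommGroup G] [NormedSpace ℝ G] [NormedAddCommGroup H] [NormedSpace ℝ H]
    {A : N → G →L[ℝ] H} {A' : N →L[ℝ] G →L[ℝ] H} {p : N} (hA : HasFDerivAt A A' p) (v : G) :
    HasFDerivAt (fun q => A q v) (A'.flip v) p :=
  (hA.clm_apply (hasFDerivAt_const v p)).congr_fderiv (by simp)

/-! ### The exterior derivative of the inverse form is the Jacobiator. -/

section ClosedForm

variable {N : Type*} [NormedAddCommGroup N] [NormedSpace ℝ N]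

theorem twoForm_swap (θ : N [⋀^Fin 2]→L[ℝ] ℝ) (u v : N) : θ ![u, v] = -θ ![v, u] := by
  have h := θ.map_swap ![v, u] (show (0 : Fin 2) ≠ 1 by decide)
  refine (congrArg θ ?_).trans h
  ext i
  fin_cases i <;> rfl

/-- Near p, θ is the image of Ω under a fixed continuous linear map, built from alternatization;
this passes differentiability from bilinear maps to alternating forms. -/
theorem differentiableAt_twoForm {θ : N → N [⋀^Fin 2]→L[ℝ] ℝ} {Ω : N → N →L[ℝ] N →L[ℝ] ℝ} {p : N}
    (hΩ : DifferentiableAt ℝ Ω p) (h : ∀ᶠ q in 𝓝 p, ∀ u v, θ q ![u, v] = Ω q u v) :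
    DifferentiableAt ℝ θ p := by
  let J : (N →L[ℝ] ℝ) →L[ℝ] N [⋀^Fin 1]→L[ℝ] ℝ :=
    (ContinuousAlternatingMap.ofSubsingletonLIE (𝕜 := ℝ) (E := N) (F := ℝ)
      (0 : Fin 1)).toContinuousLinearEquiv.toContinuousLinearMap
  have hJ : ∀ (ξ : N →L[ℝ] ℝ) (u : Fin 1 → N), J ξ u = ξ (u 0) := fun _ _ => rfl
  -- Alternatization returns Ω(u, v) - Ω(v, u), which is twice the form; hence the factor 1/2.
  have hd : DifferentiableAt ℝ (fun q => (1 / 2 : ℝ) •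
      ContinuousAlternatingMap.alternatizeUncurryFinCLM ℝ N ℝ (J ∘L Ω q)) p := by
    refine DifferentiableAt.const_smul (R := ℝ) (f := fun q =>
      ContinuousAlternatingMap.alternatizeUncurryFinCLM ℝ N ℝ (J ∘L Ω q)) ?_ _
    exact (ContinuousAlternatingMap.alternatizeUncurryFinCLM ℝ N ℝ).differentiableAt.comp p
      ((differentiableAt_const J).clm_comp hΩ)
  refine hd.congr_of_eventuallyEq ?_
  filter_upwards [h] with q hq
  ext u
  have hu : u = ![u 0, u 1] := by ext i; fin_cases i <;> rfl
  have e : ContinuousAlternatingMap.alternatizeUncurryFinCLM ℝ N ℝ (J ∘L Ω q) u =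
      Ω q (u 0) (u 1) - Ω q (u 1) (u 0) := by
    refine (ContinuousAlternatingMap.alternatizeUncurryFin_apply _ _).trans ?_
    simp [Fin.sum_univ_two, hJ, Fin.removeNth, sub_eq_add_neg]
  have h1 : θ q u = Ω q (u 0) (u 1) := by rw [← hq, ← hu]
  have h2 : Ω q (u 1) (u 0) = -Ω q (u 0) (u 1) := by
    rw [← hq, ← hq, twoForm_swap]
  change _ = (1 / 2 : ℝ) * (ContinuousAlternatingMap.alternatizeUncurryFinCLM ℝ N ℝ (J ∘L Ω q) u)
  rw [e, h2, h1]
  ring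

/-- The alternating sum has the middle term -D_b θ(a, c); skewness turns it into D_b θ(c, a), giving
the cyclic form. -/
theorem extDeriv_twoForm_apply {θ : N → N [⋀^Fin 2]→L[ℝ] ℝ} {Ω : N → N →L[ℝ] N →L[ℝ] ℝ} {p : N}
    (hΩ : DifferentiableAt ℝ Ω p) (h : ∀ᶠ q in 𝓝 p, ∀ u v, θ q ![u, v] = Ω q u v) (a b c : N) :
    extDeriv θ p ![a, b, c] =
      fderiv ℝ Ω p a b c + fderiv ℝ Ω p b c a + fderiv ℝ Ω p c a b := by
  have hf : ∀ w u v : N, fderiv ℝ (fun q => θ q ![u, v]) p w = fderiv ℝ Ω p w u v := by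
    intro w u v
    have h1 : (fun q => θ q ![u, v]) =ᶠ[𝓝 p] fun q => Ω q u v := h.mono fun q hq => hq u v
    rw [h1.fderiv_eq]
    have h2 := (hΩ.hasFDerivAt.clm_apply (hasFDerivAt_const u p)).clm_apply (hasFDerivAt_const v p)
    rw [h2.fderiv]
    simp
  have hs : ∀ w u v : N, fderiv ℝ Ω p w u v = -fderiv ℝ Ω p w v u := by
    intro w u v
    rw [← hf, ← hf, ← neg_apply, ← fderiv_fun_neg]
    congr 2
    funext q
    exact twoForm_swap _ _ _
  rw [extDeriv_apply (differentiableAt_twoForm hΩ h)]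
  have e0 : Fin.removeNth 0 ![a, b, c] = ![b, c] := by
    ext i; fin_cases i <;> rfl
  have e1 : Fin.removeNth 1 ![a, b, c] = ![a, c] := by
    ext i; fin_cases i <;> rfl
  have e2 : Fin.removeNth 2 ![a, b, c] = ![a, b] := by
    ext i; fin_cases i <;> rfl
  rw [Fin.sum_univ_three, e0, e1, e2, hf, hf, hf]
  have := hs b a c
  simp
  linarith

variable [FiniteDimensional ℝ N]
variable {E : Type*} [NormedAddCommGroup E] [NormedSpace ℝ E] [FiniteDimensional ℝ E]

omit [FiniteDimensional ℝ N] [FiniteDimensional ℝ E] in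
/-- The derivative of a 2-form `Ω` with `Ω (Y ξ, v) = ξ (A v)` and `A ∘ Y = Q`. -/
theorem fderiv_inverse_twoForm {A : N → N →L[ℝ] E} {Y : N → (E →L[ℝ] ℝ) →L[ℝ] N}
    {Q : N → (E →L[ℝ] ℝ) →L[ℝ] E} {Ω : N → N →L[ℝ] N →L[ℝ] ℝ} {p : N}
    (hA : DifferentiableAt ℝ A p) (hY : DifferentiableAt ℝ Y p) (hQ : DifferentiableAt ℝ Q p)
    (hΩ : DifferentiableAt ℝ Ω p) (hAY : ∀ᶠ q in 𝓝 p, ∀ ξ, A q (Y q ξ) = Q q ξ)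
    (hΩY : ∀ᶠ q in 𝓝 p, ∀ ξ v, Ω q (Y q ξ) v = ξ (A q v))
    (hsw : ∀ u v, Ω p u v = -Ω p v u) (w : N) (ξ η : E →L[ℝ] ℝ) :
    fderiv ℝ Ω p w (Y p ξ) (Y p η) =
      ξ (fderiv ℝ A p w (Y p η)) - η (fderiv ℝ A p w (Y p ξ)) + η (fderiv ℝ Q p w ξ) := by
  have hYd : HasFDerivAt (fun q => Y q ξ) ((fderiv ℝ Y p).flip ξ) p :=
    hasFDerivAt_apply_const hY.hasFDerivAt ξ
  have h1 : fderiv ℝ Q p w ξ = A p (fderiv ℝ Y p w ξ) + fderiv ℝ A p w (Y p ξ) := by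
    have h3 := (hasFDerivAt_apply_const hQ.hasFDerivAt ξ).unique
      ((hA.hasFDerivAt.clm_apply hYd).congr_of_eventuallyEq (hAY.mono fun q hq => (hq ξ).symm))
    exact congrArg (fun L : N →L[ℝ] E => L w) h3
  have h2 : ξ (fderiv ℝ A p w (Y p η)) =
      Ω p (fderiv ℝ Y p w ξ) (Y p η) + fderiv ℝ Ω p w (Y p ξ) (Y p η) := by
    have h3 := (ξ.hasFDerivAt.comp p (hasFDerivAt_apply_const hA.hasFDerivAt (Y p η))).unique
      ((hasFDerivAt_apply_const (hΩ.hasFDerivAt.clm_apply hYd) (Y p η)).congr_of_eventuallyEq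
        (hΩY.mono fun q hq => (hq ξ (Y p η)).symm))
    exact congrArg (fun L : N →L[ℝ] ℝ => L w) h3
  -- The derivative of Y is unknown. Skewness and the defining relation of Ω reduce its contribution
  -- to η(A (DY ξ)), which `h1` eliminates.
  have h4 : Ω p (fderiv ℝ Y p w ξ) (Y p η) = -η (A p (fderiv ℝ Y p w ξ)) := by
    rw [hsw, hΩY.self_of_nhds]
  rw [h1, h2, h4, map_add]
  ring

set_option synthInstance.maxHeartbeats 400000 in
/-- The exterior derivative of the inverse of a bivector field `P` along an integral manifold of
`Im P` is given by the Jacobiator of `P`. -/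
theorem extDeriv_eq_jacobiator {f : N → E} {p : N} {P : E → (E →L[ℝ] ℝ) →L[ℝ] E}
    {θ : N → N [⋀^Fin 2]→L[ℝ] ℝ} (hf : ContDiffAt ℝ ∞ f p) (hP : ContDiffAt ℝ ∞ P (f p))
    (hinj : Function.Injective (fderiv ℝ f p))
    (hrange : ∀ᶠ q in 𝓝 p, ∀ ξ, ∃ u, fderiv ℝ f q u = P (f q) ξ)
    (hrange' : ∀ u, ∃ ξ, P (f p) ξ = fderiv ℝ f p u)
    (hθ : ∀ᶠ q in 𝓝 p, ∀ u v ξ, P (f q) ξ = fderiv ℝ f q u → θ q ![u, v] = ξ (fderiv ℝ f q v))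
    {a b c : N} {α β γ : E →L[ℝ] ℝ} (ha : fderiv ℝ f p a = P (f p) γ)
    (hb : fderiv ℝ f p b = P (f p) α) (hc : fderiv ℝ f p c = P (f p) β) :
    extDeriv θ p ![a, b, c] = β (fderiv ℝ P (f p) (P (f p) γ) α) +
      γ (fderiv ℝ P (f p) (P (f p) α) β) + α (fderiv ℝ P (f p) (P (f p) β) γ) := by
  have hA : ContDiffAt ℝ ∞ (fderiv ℝ f) p := hf.fderiv_right (by simp)
  have hPf : ContDiffAt ℝ ∞ (fun q => P (f q)) p := hP.comp p hf
  -- A fixed left inverse L of df at p makes L ∘ df invertible nearby. This gives a smooth lift Y of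
  -- P through df, the unique one because df is injective there.
  obtain ⟨L₀, hL₀⟩ := (fderiv ℝ f p : N →ₗ[ℝ] E).exists_leftInverse_of_injective
    (LinearMap.ker_eq_bot.2 hinj)
  let L : E →L[ℝ] N := LinearMap.toContinuousLinearMap L₀
  have hL : L ∘L fderiv ℝ f p = ContinuousLinearMap.id ℝ N :=
    ContinuousLinearMap.ext fun u => LinearMap.congr_fun hL₀ u
  have inv_near : ∀ {T : N → N →L[ℝ] N}, ContDiffAt ℝ ∞ T p → T p = ContinuousLinearMap.id ℝ N →
      ContDiffAt ℝ ∞ (fun q => (T q).inverse) p ∧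
        ∀ᶠ q in 𝓝 p, (T q).inverse ∘L T q = ContinuousLinearMap.id ℝ N ∧
          T q ∘L (T q).inverse = ContinuousLinearMap.id ℝ N := by
    intro T hT hT1
    have h1 : T p = (ContinuousLinearEquiv.refl ℝ N : N →L[ℝ] N) := hT1
    refine ⟨ContDiffAt.comp p (g := ContinuousLinearMap.inverse)
      (h1 ▸ contDiffAt_map_inverse _) hT, ?_⟩
    have h2 : range ((↑) : (N ≃L[ℝ] N) → N →L[ℝ] N) ∈ 𝓝 (T p) := by
      rw [h1]; exact ContinuousLinearEquiv.nhds _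
    filter_upwards [hT.continuousAt.eventually h2] with q hq
    obtain ⟨g, hg⟩ := hq
    rw [← hg, ContinuousLinearMap.inverse_equiv]
    exact ⟨by ext; simp, by ext; simp⟩
  obtain ⟨hBs, hBi⟩ := inv_near (T := fun q => L ∘L fderiv ℝ f q)
    (contDiffAt_const.clm_comp hA) hL
  let Y : N → (E →L[ℝ] ℝ) →L[ℝ] N := fun q => (L ∘L fderiv ℝ f q).inverse ∘L L ∘L P (f q)
  have hYs : ContDiffAt ℝ ∞ Y p := hBs.clm_comp (contDiffAt_const.clm_comp hPf)
  have hYu : ∀ᶠ q in 𝓝 p, ∀ u ξ, fderiv ℝ f q u = P (f q) ξ → Y q ξ = u := by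
    filter_upwards [hBi] with q hq u ξ hu
    have := congrArg (fun A : N →L[ℝ] N => A u) hq.1
    simp only [ContinuousLinearMap.comp_apply, ContinuousLinearMap.id_apply, hu] at this
    exact this
  have hY : ∀ᶠ q in 𝓝 p, ∀ ξ, fderiv ℝ f q (Y q ξ) = P (f q) ξ := by
    filter_upwards [hYu, hrange] with q h1 h2 ξ
    obtain ⟨u, hu⟩ := h2 ξ
    rw [h1 u ξ hu, hu]
  -- A linear choice of covectors with P(s u) = df u at p. Correcting s by the inverse of Y ∘ s
  -- keeps that property at nearby points, so θ acquires the differentiable bilinear expression Ω.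
  obtain ⟨s, hs⟩ : ∃ s : N →L[ℝ] (E →L[ℝ] ℝ), ∀ u, P (f p) (s u) = fderiv ℝ f p u := by
    choose ξ hξ using hrange'
    let b := Module.finBasis ℝ N
    let s₀ : N →ₗ[ℝ] (E →L[ℝ] ℝ) := b.constr ℝ fun i => ξ (b i)
    have hs₀ : (P (f p) : (E →L[ℝ] ℝ) →ₗ[ℝ] E) ∘ₗ s₀ = (fderiv ℝ f p : N →ₗ[ℝ] E) :=
      b.ext fun i => by simp [s₀, hξ]
    exact ⟨LinearMap.toContinuousLinearMap s₀, fun u => LinearMap.congr_fun hs₀ u⟩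
  have hT1 : Y p ∘L s = ContinuousLinearMap.id ℝ N := by
    ext u
    exact hYu.self_of_nhds u (s u) (hs u).symm
  obtain ⟨hTs, hTi⟩ := inv_near (T := fun q => Y q ∘L s) (hYs.clm_comp contDiffAt_const) hT1
  let W : N → N →L[ℝ] N →L[ℝ] ℝ := fun q =>
    (ContinuousLinearMap.compL ℝ N E ℝ).flip (fderiv ℝ f q) ∘L s
  have hWs : ContDiffAt ℝ ∞ W p :=
    ((ContinuousLinearMap.contDiff _).contDiffAt.comp p hA).clm_comp contDiffAt_const
  let Ω : N → N →L[ℝ] N →L[ℝ] ℝ := fun q => W q ∘L (Y q ∘L s).inverse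
  have hΩd : DifferentiableAt ℝ Ω p := (hWs.clm_comp hTs).differentiableAt (by simp)
  have hθΩ : ∀ᶠ q in 𝓝 p, ∀ u v, θ q ![u, v] = Ω q u v := by
    filter_upwards [hTi, hY, hθ] with q h1 h2 h3 u v
    have hu : Y q (s ((Y q ∘L s).inverse u)) = u := congrArg (fun A : N →L[ℝ] N => A u) h1.2
    rw [h3 u v (s ((Y q ∘L s).inverse u)) (by rw [← h2, hu])]
    rfl
  have hΩY : ∀ᶠ q in 𝓝 p, ∀ ξ v, Ω q (Y q ξ) v = ξ (fderiv ℝ f q v) := by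
    filter_upwards [hY, hθ, hθΩ] with q h1 h2 h3 ξ v
    rw [← h3]
    exact h2 _ _ _ (h1 ξ).symm
  have hΩsw : ∀ u v, Ω p u v = -Ω p v u := fun u v => by
    rw [← hθΩ.self_of_nhds, ← hθΩ.self_of_nhds, twoForm_swap]
  set S := fderiv ℝ (fderiv ℝ f) p
  have hSsym : ∀ u v, S u v = S v u := fun u v =>
    hf.isSymmSndFDerivAt (by simpa using two_le_infty) u v
  -- The terms in the second derivative S of f cancel in the cyclic sum by symmetry of S; only the
  -- DP terms remain.
  have key : ∀ (w : N) (ξ η : E →L[ℝ] ℝ), fderiv ℝ Ω p w (Y p ξ) (Y p η) =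
      ξ (S w (Y p η)) - η (S w (Y p ξ)) + η (fderiv ℝ P (f p) (fderiv ℝ f p w) ξ) := by
    intro w ξ η
    have hPd : fderiv ℝ (fun q => P (f q)) p = fderiv ℝ P (f p) ∘L fderiv ℝ f p :=
      fderiv_comp p (hP.differentiableAt (by simp)) (hf.differentiableAt (by simp))
    have := fderiv_inverse_twoForm (hA.differentiableAt (by simp)) (hYs.differentiableAt (by simp))
      (hPf.differentiableAt (by simp)) hΩd hY hΩY hΩsw w ξ η
    rwa [hPd] at this
  have hYa : Y p γ = a := hYu.self_of_nhds _ _ ha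
  have hYb : Y p α = b := hYu.self_of_nhds _ _ hb
  have hYc : Y p β = c := hYu.self_of_nhds _ _ hc
  have k1 := key a α β
  have k2 := key b β γ
  have k3 := key c γ α
  rw [hYa, hYc] at *
  rw [hYb] at *
  rw [extDeriv_twoForm_apply hΩd hθΩ, k1, k2, k3, ha, hb, hc, hSsym c a, hSsym c b, hSsym b a]
  ring

end ClosedForm

/-! ### Derivatives of charts and coordinate vector fields. -/

section ChartDerivatives

variable {E : Type*} [NormedAddCommGroup E] [NormedSpace ℝ E]
  {M : Type*} [TopologicalSpace M] [ChartedSpace E M] [IsManifold 𝓘(ℝ, E) ∞ M]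
  {φ : OpenPartialHomeomorph M E}

omit [IsManifold 𝓘(ℝ, E) ∞ M] in
theorem mdifferentiable_of_mem_maximalAtlas (hφ : φ ∈ IsManifold.maximalAtlas 𝓘(ℝ, E) ∞ M) :
    φ.MDifferentiable 𝓘(ℝ, E) 𝓘(ℝ, E) :=
  ⟨fun _ hx => ((contMDiffAt_of_mem_maximalAtlas hφ hx).mdifferentiableAt
      (by simp)).mdifferentiableWithinAt,
    fun _ hx => ((contMDiffAt_symm_of_mem_maximalAtlas hφ hx).mdifferentiableAt
      (by simp)).mdifferentiableWithinAt⟩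

omit [IsManifold 𝓘(ℝ, E) ∞ M] in
theorem mvfderiv_comp_symm (hφ : φ ∈ IsManifold.maximalAtlas 𝓘(ℝ, E) ∞ M) {x : M}
    (hx : x ∈ φ.source) (e : E) :
    mvfderiv 𝓘(ℝ, E) φ x
      (mfderiv 𝓘(ℝ, E) 𝓘(ℝ, E) φ.symm (φ x) ((fromTangentSpace (𝕜 := ℝ) (φ x)).symm e)) = e := by
  have h := (mdifferentiable_of_mem_maximalAtlas hφ).comp_symm_deriv (φ.map_source hx)
  rw [φ.left_inv hx] at h
  exact DFunLike.congr_fun h e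

omit [IsManifold 𝓘(ℝ, E) ∞ M] in
theorem mfderiv_symm_mvfderiv (hφ : φ ∈ IsManifold.maximalAtlas 𝓘(ℝ, E) ∞ M) {x : M}
    (hx : x ∈ φ.source) (v : TangentSpace 𝓘(ℝ, E) x) :
    mfderiv 𝓘(ℝ, E) 𝓘(ℝ, E) φ.symm (φ x) ((fromTangentSpace (𝕜 := ℝ) (φ x)).symm
      (mvfderiv 𝓘(ℝ, E) φ x v)) = v :=
  DFunLike.congr_fun ((mdifferentiable_of_mem_maximalAtlas hφ).symm_comp_deriv hx) v

/-- The derivative of a chart as a linear isomorphism. -/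
def chartDeriv (hφ : φ ∈ IsManifold.maximalAtlas 𝓘(ℝ, E) ∞ M) {x : M} (hx : x ∈ φ.source) :
    TangentSpace 𝓘(ℝ, E) x ≃L[ℝ] E :=
  ContinuousLinearEquiv.equivOfInverse (mvfderiv 𝓘(ℝ, E) φ x)
    (mfderiv 𝓘(ℝ, E) 𝓘(ℝ, E) φ.symm (φ x) ∘L
      ((fromTangentSpace (𝕜 := ℝ) (φ x)).symm : E →L[ℝ] TangentSpace 𝓘(ℝ, E) (φ x)))
    (mfderiv_symm_mvfderiv hφ hx) (mvfderiv_comp_symm hφ hx)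

omit [IsManifold 𝓘(ℝ, E) ∞ M] in
theorem coe_chartDeriv (hφ : φ ∈ IsManifold.maximalAtlas 𝓘(ℝ, E) ∞ M) {x : M}
    (hx : x ∈ φ.source) : (chartDeriv hφ hx : TangentSpace 𝓘(ℝ, E) x →L[ℝ] E) =
      mvfderiv 𝓘(ℝ, E) φ x := rfl

omit [IsManifold 𝓘(ℝ, E) ∞ M] in
theorem isInvertible_mvfderiv (hφ : φ ∈ IsManifold.maximalAtlas 𝓘(ℝ, E) ∞ M) {x : M}
    (hx : x ∈ φ.source) : (mvfderiv 𝓘(ℝ, E) φ x).IsInvertible :=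
  ⟨chartDeriv hφ hx, rfl⟩

/-- The vector field which in the chart `φ` is the constant field `e`. -/
def chartField (φ : OpenPartialHomeomorph M E) (e : E) (x : M) : TangentSpace 𝓘(ℝ, E) x :=
  (mvfderiv 𝓘(ℝ, E) φ x).inverse e

omit [IsManifold 𝓘(ℝ, E) ∞ M] in
theorem mvfderiv_chartField (hφ : φ ∈ IsManifold.maximalAtlas 𝓘(ℝ, E) ∞ M) {x : M}
    (hx : x ∈ φ.source) (e : E) : mvfderiv 𝓘(ℝ, E) φ x (chartField φ e x) = e := by
  rw [chartField, ← coe_chartDeriv hφ hx, ContinuousLinearMap.inverse_equiv]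
  exact (chartDeriv hφ hx).apply_symm_apply e

omit [IsManifold 𝓘(ℝ, E) ∞ M] in
theorem chartField_mvfderiv (hφ : φ ∈ IsManifold.maximalAtlas 𝓘(ℝ, E) ∞ M) {x : M}
    (hx : x ∈ φ.source) (v : TangentSpace 𝓘(ℝ, E) x) :
    chartField φ (mvfderiv 𝓘(ℝ, E) φ x v) x = v := by
  rw [chartField, ← coe_chartDeriv hφ hx, ContinuousLinearMap.inverse_equiv]
  exact (chartDeriv hφ hx).symm_apply_apply v

omit [IsManifold 𝓘(ℝ, E) ∞ M] in
theorem mvfderiv_injective (hφ : φ ∈ IsManifold.maximalAtlas 𝓘(ℝ, E) ∞ M) {x : M}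
    (hx : x ∈ φ.source) : Function.Injective (mvfderiv 𝓘(ℝ, E) φ x) :=
  (chartDeriv hφ hx).injective

/-- The coordinate field is the pullback by φ of a constant field on E. -/
theorem contMDiffAt_chartField [CompleteSpace E] (hφ : φ ∈ IsManifold.maximalAtlas 𝓘(ℝ, E) ∞ M)
    {x : M} (hx : x ∈ φ.source) (e : E) :
    ContMDiffAt 𝓘(ℝ, E) 𝓘(ℝ, E).tangent ∞ (fun y => TotalSpace.mk' E y (chartField φ e y)) x := by
  have hV : ContMDiffAt 𝓘(ℝ, E) 𝓘(ℝ, E).tangent ∞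
      (fun y : E => TotalSpace.mk' E (E := (TangentSpace 𝓘(ℝ, E) : E → Type _)) y
        ((fromTangentSpace (𝕜 := ℝ) y).symm e)) (φ x) := by
    rw [contMDiffAt_vectorSpace_iff_contDiffAt]
    exact contDiffAt_const
  exact hV.mpullback_vectorField_preimage (contMDiffAt_of_mem_maximalAtlas hφ hx)
    (isInvertible_mvfderiv hφ hx) (by simp)

/-- The differential of a smooth function with values in a vector space is smooth. -/
theorem contMDiffAt_mvfderiv {F : Type*} [NormedAddCommGroup F] [NormedSpace ℝ F] {f : M → F}
    {x : M} (hf : ContMDiffAt 𝓘(ℝ, E) 𝓘(ℝ, F) ∞ f x) :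
    ContMDiffAt 𝓘(ℝ, E) (𝓘(ℝ, E).prod 𝓘(ℝ, E →L[ℝ] F)) ∞
      (fun y => TotalSpace.mk' (E →L[ℝ] F)
        (E := fun y : M => TangentSpace 𝓘(ℝ, E) y →L[ℝ] Bundle.Trivial M F y) y
        (mvfderiv 𝓘(ℝ, E) f y)) x := by
  rw [contMDiffAt_hom_bundle]
  refine ⟨contMDiffAt_id, ?_⟩
  have h := hf.mfderiv_const (m := ∞) (by simp)
  refine h.congr_of_eventuallyEq (Eventually.of_forall fun y => ?_)
  simp only [inTangentCoordinates, ContinuousLinearMap.inCoordinates]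
  ext v
  simp
  rfl

end ChartDerivatives

/-! ### Calculus in a chart and the Lie bracket. -/

section ChartCalculus

variable {E : Type*} [NormedAddCommGroup E] [NormedSpace ℝ E]
  {F : Type*} [NormedAddCommGroup F] [NormedSpace ℝ F]
  {M : Type*} [TopologicalSpace M] [ChartedSpace E M] [IsManifold 𝓘(ℝ, E) ∞ M]
  {φ : OpenPartialHomeomorph M E}

omit [IsManifold 𝓘(ℝ, E) ∞ M] in
theorem mvfderiv_congr {f g : M → F} {x : M} (h : f =ᶠ[𝓝 x] g) :
    mvfderiv 𝓘(ℝ, E) f x = mvfderiv 𝓘(ℝ, E) g x := by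
  ext v
  have := h.mfderiv_eq (I := 𝓘(ℝ, E)) (I' := 𝓘(ℝ, F))
  exact DFunLike.congr_fun this v

omit [IsManifold 𝓘(ℝ, E) ∞ M] in
theorem fderiv_comp_chart_symm (hφ : φ ∈ IsManifold.maximalAtlas 𝓘(ℝ, E) ∞ M) {x : M}
    (hx : x ∈ φ.source) {g : M → F} (hg : MDifferentiableAt 𝓘(ℝ, E) 𝓘(ℝ, F) g x)
    (v : TangentSpace 𝓘(ℝ, E) x) :
    fderiv ℝ (g ∘ φ.symm) (φ x) (mvfderiv 𝓘(ℝ, E) φ x v) = mvfderiv 𝓘(ℝ, E) g x v := by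
  have hg' : MDifferentiableAt 𝓘(ℝ, E) 𝓘(ℝ, F) g (φ.symm (φ x)) := by rwa [φ.left_inv hx]
  have h := mfderiv_comp (φ x) hg'
    ((mdifferentiable_of_mem_maximalAtlas hφ).mdifferentiableAt_symm (φ.map_source hx))
  rw [← mfderiv_eq_fderiv, h, φ.left_inv hx]
  exact congrArg _ (mfderiv_symm_mvfderiv hφ hx v)

omit [IsManifold 𝓘(ℝ, E) ∞ M] in
theorem contDiffAt_comp_chart_symm (hφ : φ ∈ IsManifold.maximalAtlas 𝓘(ℝ, E) ∞ M) {p : E}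
    (hp : p ∈ φ.target) {g : M → F} (hg : ContMDiffAt 𝓘(ℝ, E) 𝓘(ℝ, F) ∞ g (φ.symm p)) :
    ContDiffAt ℝ ∞ (g ∘ φ.symm) p :=
  (hg.comp p (contMDiffAt_symm_of_mem_maximalAtlas hφ hp)).contDiffAt

theorem contMDiffAt_mvfderiv_apply {f : M → F} {x : M}
    (hf : ContMDiffAt 𝓘(ℝ, E) 𝓘(ℝ, F) ∞ f x) {Y : ∀ x : M, TangentSpace 𝓘(ℝ, E) x}
    (hY : ContMDiffAt 𝓘(ℝ, E) 𝓘(ℝ, E).tangent ∞ (fun y => TotalSpace.mk' E y (Y y)) x) :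
    ContMDiffAt 𝓘(ℝ, E) 𝓘(ℝ, F) ∞ (fun y => mvfderiv 𝓘(ℝ, E) f y (Y y)) x := by
  have h := (contMDiffAt_mvfderiv hf).clm_bundle_apply (F₁ := E) (F₂ := F)
    (E₁ := (TangentSpace 𝓘(ℝ, E) : M → Type _)) (E₂ := Bundle.Trivial M F) (b := id) (v := Y) hY
  exact ((contMDiffAt_totalSpace).1 h).2

theorem mdifferentiableAt_mvfderiv_apply {f : M → F} {x : M}
    (hf : ContMDiffAt 𝓘(ℝ, E) 𝓘(ℝ, F) ∞ f x) {Y : ∀ x : M, TangentSpace 𝓘(ℝ, E) x}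
    (hY : MDifferentiableAt 𝓘(ℝ, E) 𝓘(ℝ, E).tangent (fun y => TotalSpace.mk' E y (Y y)) x) :
    MDifferentiableAt 𝓘(ℝ, E) 𝓘(ℝ, F) (fun y => mvfderiv 𝓘(ℝ, E) f y (Y y)) x := by
  have h := MDifferentiableAt.clm_bundle_apply (F₁ := E) (F₂ := F)
    (E₁ := (TangentSpace 𝓘(ℝ, E) : M → Type _)) (E₂ := Bundle.Trivial M F) (b := id) (v := Y)
    ((contMDiffAt_mvfderiv hf).mdifferentiableAt (by simp)) hY
  exact ((mdifferentiableAt_totalSpace _ _).1 h).2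

theorem contMDiffAt_chartField_apply [CompleteSpace E]
    (hφ : φ ∈ IsManifold.maximalAtlas 𝓘(ℝ, E) ∞ M)
    {x : M} (hx : x ∈ φ.source) {g : M → E} (hg : ContMDiffAt 𝓘(ℝ, E) 𝓘(ℝ, E) ∞ g x) :
    ContMDiffAt 𝓘(ℝ, E) 𝓘(ℝ, E).tangent ∞
      (fun y => TotalSpace.mk' E y (chartField φ (g y) y)) x := by
  have hV : ContMDiffAt 𝓘(ℝ, E) 𝓘(ℝ, E).tangent ∞
      (fun y : E => TotalSpace.mk' E (E := (TangentSpace 𝓘(ℝ, E) : E → Type _)) y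
        ((fromTangentSpace (𝕜 := ℝ) y).symm ((g ∘ φ.symm) y))) (φ x) := by
    rw [contMDiffAt_vectorSpace_iff_contDiffAt]
    refine contDiffAt_comp_chart_symm hφ (φ.map_source hx) ?_
    rwa [φ.left_inv hx]
  refine (hV.mpullback_vectorField_preimage (contMDiffAt_of_mem_maximalAtlas hφ hx)
    (isInvertible_mvfderiv hφ hx) (by simp)).congr_of_eventuallyEq ?_
  filter_upwards [φ.open_source.mem_nhds hx] with y hy
  change TotalSpace.mk' E y (chartField φ (g y) y) =
    TotalSpace.mk' E y (chartField φ (g (φ.symm (φ y))) y)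
  rw [φ.left_inv hy]

/-- The Lie bracket of vector fields in a chart. -/
theorem mvfderiv_mlieBracket [FiniteDimensional ℝ E]
    (hφ : φ ∈ IsManifold.maximalAtlas 𝓘(ℝ, E) ∞ M) {x : M}
    (hx : x ∈ φ.source) {X Y : ∀ x : M, TangentSpace 𝓘(ℝ, E) x}
    (hX : MDifferentiableAt 𝓘(ℝ, E) 𝓘(ℝ, E).tangent (fun y => TotalSpace.mk' E y (X y)) x)
    (hY : MDifferentiableAt 𝓘(ℝ, E) 𝓘(ℝ, E).tangent (fun y => TotalSpace.mk' E y (Y y)) x) :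
    mvfderiv 𝓘(ℝ, E) φ x (VectorField.mlieBracket 𝓘(ℝ, E) X Y x) =
      mvfderiv 𝓘(ℝ, E) (fun y => mvfderiv 𝓘(ℝ, E) φ y (Y y)) x (X x) -
      mvfderiv 𝓘(ℝ, E) (fun y => mvfderiv 𝓘(ℝ, E) φ y (X y)) x (Y x) := by
  have : CompleteSpace E := FiniteDimensional.complete ℝ E
  have : IsManifold 𝓘(ℝ, E) (minSmoothness ℝ 3) M := by
    rw [minSmoothness_of_isRCLikeNormedField]
    exact IsManifold.of_le (n := ∞) (WithTop.coe_le_coe.2 (le_top (a := (3 : ℕ∞))))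
  have hφx := φ.map_source hx
  have hsymm := φ.left_inv hx
  -- Pulling back along `φ.symm` reads a field in the chart, so naturality of the bracket reduces
  -- the formula to the one in E.
  have hpull : ∀ (Z : ∀ x : M, TangentSpace 𝓘(ℝ, E) x), ∀ p ∈ φ.target,
      VectorField.mpullback 𝓘(ℝ, E) 𝓘(ℝ, E) φ.symm Z p =
        (fromTangentSpace (𝕜 := ℝ) p).symm
          (mvfderiv 𝓘(ℝ, E) φ (φ.symm p) (Z (φ.symm p))) := by
    intro Z p hp
    have hq := φ.map_target hp
    have h1 : mfderiv 𝓘(ℝ, E) 𝓘(ℝ, E) φ.symm p =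
        (((fromTangentSpace (𝕜 := ℝ) p).trans ((chartDeriv hφ hq).symm)) :
          TangentSpace 𝓘(ℝ, E) p →L[ℝ] TangentSpace 𝓘(ℝ, E) (φ.symm p)) := by
      have h2 := φ.right_inv hp
      ext v
      have h3 := (mdifferentiable_of_mem_maximalAtlas hφ).comp_symm_deriv hp
      apply mvfderiv_injective hφ hq
      refine (DFunLike.congr_fun h3 v).trans ?_
      exact ((chartDeriv hφ hq).apply_symm_apply _).symm
    rw [VectorField.mpullback_apply, h1, ContinuousLinearMap.inverse_equiv]
    rfl
  have hX' : MDifferentiableAt 𝓘(ℝ, E) 𝓘(ℝ, E).tangent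
      (fun y => TotalSpace.mk' E y (X y)) (φ.symm (φ x)) := by rwa [hsymm]
  have hY' : MDifferentiableAt 𝓘(ℝ, E) 𝓘(ℝ, E).tangent
      (fun y => TotalSpace.mk' E y (Y y)) (φ.symm (φ x)) := by rwa [hsymm]
  have key := VectorField.mpullback_mlieBracket (n := ∞) (f := φ.symm) (x₀ := φ x) hX' hY'
    (contMDiffAt_symm_of_mem_maximalAtlas hφ hφx)
    (by rw [minSmoothness_of_isRCLikeNormedField]; exact two_le_infty)
  have hE : ∀ V W : ∀ p : E, TangentSpace 𝓘(ℝ, E) p,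
      VectorField.mlieBracket 𝓘(ℝ, E) V W = VectorField.lieBracket ℝ V W := by
    intro V W
    rw [← VectorField.mlieBracketWithin_univ,
      VectorField.mlieBracketWithin_eq_lieBracketWithin]
    exact VectorField.lieBracketWithin_univ
  rw [hpull _ _ hφx, hE, hsymm] at key
  have hd : ∀ (Z : ∀ x : M, TangentSpace 𝓘(ℝ, E) x),
      MDifferentiableAt 𝓘(ℝ, E) 𝓘(ℝ, E).tangent (fun y => TotalSpace.mk' E y (Z y)) x →
      ∀ v, fderiv ℝ (VectorField.mpullback 𝓘(ℝ, E) 𝓘(ℝ, E) φ.symm Z : E → E) (φ x)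
        (mvfderiv 𝓘(ℝ, E) φ x v) = mvfderiv 𝓘(ℝ, E) (fun y => mvfderiv 𝓘(ℝ, E) φ y (Z y)) x v := by
    intro Z hZ v
    rw [← fderiv_comp_chart_symm hφ hx (mdifferentiableAt_mvfderiv_apply
      (contMDiffAt_of_mem_maximalAtlas hφ hx) hZ)]
    have : (VectorField.mpullback 𝓘(ℝ, E) 𝓘(ℝ, E) φ.symm Z : E → E) =ᶠ[𝓝 (φ x)]
        (fun y => mvfderiv 𝓘(ℝ, E) φ y (Z y)) ∘ φ.symm := by
      filter_upwards [φ.open_target.mem_nhds hφx] with p hp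
      exact hpull Z p hp
    rw [this.fderiv_eq]
  refine key.trans ?_
  have hv : ∀ Z : ∀ x : M, TangentSpace 𝓘(ℝ, E) x,
      VectorField.mpullback 𝓘(ℝ, E) 𝓘(ℝ, E) φ.symm Z (φ x) = mvfderiv 𝓘(ℝ, E) φ x (Z x) := by
    intro Z
    rw [hpull Z _ hφx, hsymm]
    rfl
  have e1 := hd Y hY (X x)
  have e2 := hd X hX (Y x)
  rw [← hv X] at e1
  rw [← hv Y] at e2
  exact congrArg₂ (· - ·) e1 e2

end ChartCalculus

/-! ### Components of a bivector field in a chart. -/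

section ChartRepresentation

variable {E : Type*} [NormedAddCommGroup E] [NormedSpace ℝ E]
  {M : Type*} [TopologicalSpace M] [ChartedSpace E M] [IsManifold 𝓘(ℝ, E) ∞ M]
  {φ : OpenPartialHomeomorph M E}

theorem contMDiffAt_bivector_apply (Θ : Bivector E M) {x : M}
    {ξ : ∀ x : M, TangentSpace 𝓘(ℝ, E) x →L[ℝ] ℝ}
    (hξ : ContMDiffAt 𝓘(ℝ, E) (𝓘(ℝ, E).prod 𝓘(ℝ, E →L[ℝ] ℝ)) ∞
      (fun x => TotalSpace.mk' (E →L[ℝ] ℝ)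
        (E := fun x : M => TangentSpace 𝓘(ℝ, E) x →L[ℝ] ℝ) x (ξ x)) x) :
    ContMDiffAt 𝓘(ℝ, E) 𝓘(ℝ, E).tangent ∞
      (fun y => TotalSpace.mk' E y (Θ.toFun y (ξ y))) x :=
  ContMDiffAt.clm_bundle_apply (F₁ := E →L[ℝ] ℝ) (F₂ := E)
    (E₁ := fun x : M => TangentSpace 𝓘(ℝ, E) x →L[ℝ] ℝ)
    (E₂ := (TangentSpace 𝓘(ℝ, E) : M → Type _)) (b := id) (v := ξ) (Θ.smooth x) hξ

/-- The coordinate 1-form of a linear functional on the model space is smooth. -/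
theorem contMDiffAt_coordForm (hφ : φ ∈ IsManifold.maximalAtlas 𝓘(ℝ, E) ∞ M) {x : M}
    (hx : x ∈ φ.source) (α : E →L[ℝ] ℝ) :
    ContMDiffAt 𝓘(ℝ, E) (𝓘(ℝ, E).prod 𝓘(ℝ, E →L[ℝ] ℝ)) ∞
      (fun x => TotalSpace.mk' (E →L[ℝ] ℝ)
        (E := fun x : M => TangentSpace 𝓘(ℝ, E) x →L[ℝ] ℝ) x (α ∘L mvfderiv 𝓘(ℝ, E) φ x)) x := by
  have hφ' := contMDiffAt_of_mem_maximalAtlas hφ hx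
  have h := contMDiffAt_mvfderiv (f := α ∘ φ) (x := x)
    ((α.contDiff.contDiffAt.contMDiffAt).comp x hφ')
  refine h.congr_of_eventuallyEq ?_
  filter_upwards [φ.open_source.mem_nhds hx] with y hy
  have h1 := mfderiv_comp y (α.differentiableAt (x := φ y)).mdifferentiableAt
    ((contMDiffAt_of_mem_maximalAtlas hφ hy).mdifferentiableAt (by simp))
  rw [mfderiv_eq_fderiv, α.fderiv] at h1
  change TotalSpace.mk' _ y _ = TotalSpace.mk' _ y _
  congr 1
  exact h1.symm

/-- The components of a bivector field in a chart. -/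
def chartRep (Θ : Bivector E M) (φ : OpenPartialHomeomorph M E) (p : E) : (E →L[ℝ] ℝ) →L[ℝ] E :=
  mvfderiv 𝓘(ℝ, E) φ (φ.symm p) ∘L Θ.toFun (φ.symm p) ∘L
    ContinuousLinearMap.precomp ℝ (mvfderiv 𝓘(ℝ, E) φ (φ.symm p))

theorem chartRep_apply (Θ : Bivector E M) (φ : OpenPartialHomeomorph M E) (p : E)
    (α : E →L[ℝ] ℝ) : chartRep Θ φ p α = mvfderiv 𝓘(ℝ, E) φ (φ.symm p)
      (Θ.toFun (φ.symm p) (α ∘L mvfderiv 𝓘(ℝ, E) φ (φ.symm p))) := rfl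

theorem chartRep_apply_of_mem (Θ : Bivector E M) {x : M} (hx : x ∈ φ.source)
    (α : E →L[ℝ] ℝ) : chartRep Θ φ (φ x) α = mvfderiv 𝓘(ℝ, E) φ x
      (Θ.toFun x (α ∘L mvfderiv 𝓘(ℝ, E) φ x)) := by
  rw [chartRep_apply, φ.left_inv hx]

theorem isSkew_chartRep (Θ : Bivector E M) (φ : OpenPartialHomeomorph M E) (p : E) :
    IsSkew (chartRep Θ φ p) := fun α β =>
  Θ.skew (φ.symm p) (α ∘L mvfderiv 𝓘(ℝ, E) φ (φ.symm p)) (β ∘L mvfderiv 𝓘(ℝ, E) φ (φ.symm p))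

omit [IsManifold 𝓘(ℝ, E) ∞ M] in
theorem exists_coordForm (hφ : φ ∈ IsManifold.maximalAtlas 𝓘(ℝ, E) ∞ M) {x : M}
    (hx : x ∈ φ.source) (ξ : TangentSpace 𝓘(ℝ, E) x →L[ℝ] ℝ) :
    ∃ α : E →L[ℝ] ℝ, α ∘L mvfderiv 𝓘(ℝ, E) φ x = ξ := by
  refine ⟨ξ ∘L ((chartDeriv hφ hx).symm : E →L[ℝ] TangentSpace 𝓘(ℝ, E) x), ?_⟩
  ext v
  exact congrArg ξ ((chartDeriv hφ hx).symm_apply_apply v)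

/-- In finite dimension an operator-valued map is smooth once it is smooth on each fixed covector α,
where it is dφ applied to the vector field Θ(α ∘ dφ). -/
theorem contDiffAt_chartRep [FiniteDimensional ℝ E] (Θ : Bivector E M)
    (hφ : φ ∈ IsManifold.maximalAtlas 𝓘(ℝ, E) ∞ M) {p : E} (hp : p ∈ φ.target) :
    ContDiffAt ℝ ∞ (chartRep Θ φ) p := by
  have : ContDiffOn ℝ ∞ (chartRep Θ φ) φ.target := by
    rw [contDiffOn_clm_apply]
    intro α q hq
    have hx := φ.map_target hq
    exact (contDiffAt_comp_chart_symm hφ hq (contMDiffAt_mvfderiv_apply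
      (contMDiffAt_of_mem_maximalAtlas hφ hx)
      (contMDiffAt_bivector_apply Θ (contMDiffAt_coordForm hφ hx α)))).contDiffWithinAt
  exact (this p hp).contDiffAt (φ.open_target.mem_nhds hp)

variable [FiniteDimensional ℝ E]

omit [FiniteDimensional ℝ E] in
theorem mem_image_iff (Θ : Bivector E M)
    (hφ : φ ∈ IsManifold.maximalAtlas 𝓘(ℝ, E) ∞ M) {x : M} (hx : x ∈ φ.source)
    (v : TangentSpace 𝓘(ℝ, E) x) :
    v ∈ Θ.image x ↔ ∃ α, chartRep Θ φ (φ x) α = mvfderiv 𝓘(ℝ, E) φ x v := by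
  constructor
  · rintro ⟨ξ, rfl⟩
    obtain ⟨α, rfl⟩ := exists_coordForm hφ hx ξ
    exact ⟨α, chartRep_apply_of_mem Θ hx α⟩
  · rintro ⟨α, hα⟩
    rw [chartRep_apply_of_mem Θ hx] at hα
    exact ⟨_, mvfderiv_injective hφ hx hα⟩

omit [FiniteDimensional ℝ E] in
theorem finrank_im_chartRep (Θ : Bivector E M)
    (hφ : φ ∈ IsManifold.maximalAtlas 𝓘(ℝ, E) ∞ M) {x : M} (hx : x ∈ φ.source) :
    Module.finrank ℝ (im (chartRep Θ φ (φ x))) = Module.finrank ℝ (Θ.image x) := by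
  have h : im (chartRep Θ φ (φ x)) = (Θ.image x).map
      ((chartDeriv hφ hx).toLinearEquiv : TangentSpace 𝓘(ℝ, E) x →ₗ[ℝ] E) := by
    ext e
    rw [Submodule.mem_map]
    constructor
    · rintro ⟨α, rfl⟩
      exact ⟨_, ⟨_, rfl⟩, (chartRep_apply_of_mem Θ hx α).symm⟩
    · rintro ⟨v, hv, rfl⟩
      obtain ⟨α, hα⟩ := (mem_image_iff Θ hφ hx v).1 hv
      exact ⟨α, hα⟩
  rw [h]
  exact LinearEquiv.finrank_map_eq _ _

end ChartRepresentation

/-! ### Integral manifolds, closedness and local constancy. -/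

section Leaves

variable {E : Type*} [NormedAddCommGroup E] [NormedSpace ℝ E] [FiniteDimensional ℝ E]
  {M : Type*} [TopologicalSpace M] [ChartedSpace E M] [IsManifold 𝓘(ℝ, E) ∞ M]
  {φ : OpenPartialHomeomorph M E}

/-- If the Jacobi identity holds in every chart, then a bivector field of constant rank is locally
constant. -/
theorem isLocallyConstant_of_jacobiAt (Θ : Bivector E M) (hr : Θ.HasConstantRank)
    (hJ : ∀ φ ∈ IsManifold.maximalAtlas 𝓘(ℝ, E) ∞ M, ∀ x ∈ φ.source,
      JacobiAt (chartRep Θ φ) (φ x)) : Θ.IsLocallyConstant := by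
  intro x
  obtain ⟨r, hr⟩ := hr
  set φ := chartAt E x with hφ_def
  have hφ : φ ∈ IsManifold.maximalAtlas 𝓘(ℝ, E) ∞ M := IsManifold.chart_mem_maximalAtlas x
  have hx : x ∈ φ.source := mem_chart_source E x
  have hev : ∀ᶠ p in 𝓝 (φ x), p ∈ φ.target := φ.open_target.mem_nhds (φ.map_source hx)
  obtain ⟨ψ, C, hψx, -, hψ, hψ', hC⟩ := exists_constant_coordinates (P := chartRep Θ φ) (r := r)
    (Q := fun p => p ∈ φ.target)
    (hev.mono fun p hp => contDiffAt_chartRep Θ hφ hp)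
    (Eventually.of_forall fun p => isSkew_chartRep Θ φ p)
    (hev.mono fun p hp => by
      have := hJ φ hφ _ (φ.map_target hp)
      rwa [φ.right_inv hp] at this)
    (hev.mono fun p hp => by
      have := finrank_im_chartRep Θ hφ (φ.map_target hp)
      rwa [φ.right_inv hp, hr] at this) hev
  refine ⟨φ.trans ψ, ?_, ?_, fun α β => β (C α), ?_⟩
  · rw [IsManifold.mem_maximalAtlas_iff_contMDiffOn]
    constructor
    · intro y hy
      rw [OpenPartialHomeomorph.trans_source] at hy
      exact ((hψ _ hy.2).contMDiffAt.comp y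
        (contMDiffAt_of_mem_maximalAtlas hφ hy.1)).contMDiffWithinAt
    · intro q hq
      rw [OpenPartialHomeomorph.trans_target] at hq
      exact ((contMDiffAt_symm_of_mem_maximalAtlas hφ hq.2).comp q
        (hψ' _ hq.1).contMDiffAt).contMDiffWithinAt
  · rw [OpenPartialHomeomorph.trans_source]
    exact ⟨hx, hψx⟩
  · intro y hy α β
    rw [OpenPartialHomeomorph.trans_source] at hy
    have hd : mvfderiv 𝓘(ℝ, E) (φ.trans ψ) y = fderiv ℝ ψ (φ y) ∘L mvfderiv 𝓘(ℝ, E) φ y := by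
      have := mfderiv_comp y ((hψ _ hy.2).contMDiffAt.mdifferentiableAt (by simp))
        ((contMDiffAt_of_mem_maximalAtlas hφ hy.1).mdifferentiableAt (by simp))
      rw [mfderiv_eq_fderiv] at this
      exact this
    have h1 := hC _ hy.2 α
    rw [chartRep_apply_of_mem Θ hy.1] at h1
    rw [hd, ContinuousLinearMap.comp_apply, ← ContinuousLinearMap.comp_assoc]
    exact congrArg β h1

section Patch

variable {k : ℕ} {U : Set (EuclideanSpace ℝ (Fin k))} {f : EuclideanSpace ℝ (Fin k) → M}

omit [FiniteDimensional ℝ E] [IsManifold 𝓘(ℝ, E) ∞ M] in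
theorem contMDiffAt_of_isIntegralPatch {D : ∀ x : M, Submodule ℝ (TangentSpace 𝓘(ℝ, E) x)}
    (hf : IsIntegralPatch D U f) {p : EuclideanSpace ℝ (Fin k)} (hp : p ∈ U) :
    ContMDiffAt 𝓘(ℝ, EuclideanSpace ℝ (Fin k)) 𝓘(ℝ, E) ∞ f p :=
  (hf.smooth p hp).contMDiffAt (hf.isOpen.mem_nhds hp)

omit [FiniteDimensional ℝ E] [IsManifold 𝓘(ℝ, E) ∞ M] in
theorem fderiv_chart_comp_patch {D : ∀ x : M, Submodule ℝ (TangentSpace 𝓘(ℝ, E) x)}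
    (hf : IsIntegralPatch D U f) (hφ : φ ∈ IsManifold.maximalAtlas 𝓘(ℝ, E) ∞ M)
    {p : EuclideanSpace ℝ (Fin k)} (hp : p ∈ U) (hpφ : f p ∈ φ.source)
    (u : EuclideanSpace ℝ (Fin k)) :
    fderiv ℝ (φ ∘ f) p u = mvfderiv 𝓘(ℝ, E) φ (f p)
      (mfderiv 𝓘(ℝ, EuclideanSpace ℝ (Fin k)) 𝓘(ℝ, E) f p
        ((fromTangentSpace (𝕜 := ℝ) p).symm u)) := by
  have := mfderiv_comp p ((contMDiffAt_of_mem_maximalAtlas hφ hpφ).mdifferentiableAt (by simp))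
    ((contMDiffAt_of_isIntegralPatch hf hp).mdifferentiableAt (by simp))
  rw [mfderiv_eq_fderiv] at this
  exact DFunLike.congr_fun this u

omit [FiniteDimensional ℝ E] in
theorem exists_fderiv_chart_comp_patch (Θ : Bivector E M) (hf : IsIntegralPatch Θ.image U f)
    (hφ : φ ∈ IsManifold.maximalAtlas 𝓘(ℝ, E) ∞ M)
    {p : EuclideanSpace ℝ (Fin k)} (hp : p ∈ U) (hpφ : f p ∈ φ.source) (ξ : E →L[ℝ] ℝ) :
    ∃ u, fderiv ℝ (φ ∘ f) p u = chartRep Θ φ (φ (f p)) ξ := by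
  obtain ⟨u, hu⟩ := (hf.tangent p hp _).1 ⟨ξ ∘L mvfderiv 𝓘(ℝ, E) φ (f p), rfl⟩
  refine ⟨fromTangentSpace (𝕜 := ℝ) p u, ?_⟩
  rw [fderiv_chart_comp_patch hf hφ hp hpφ, chartRep_apply_of_mem Θ hpφ]
  exact congrArg _ hu

omit [FiniteDimensional ℝ E] in
theorem exists_chartRep_eq_fderiv (Θ : Bivector E M) (hf : IsIntegralPatch Θ.image U f)
    (hφ : φ ∈ IsManifold.maximalAtlas 𝓘(ℝ, E) ∞ M)
    {p : EuclideanSpace ℝ (Fin k)} (hp : p ∈ U) (hpφ : f p ∈ φ.source)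
    (u : EuclideanSpace ℝ (Fin k)) :
    ∃ ξ, chartRep Θ φ (φ (f p)) ξ = fderiv ℝ (φ ∘ f) p u := by
  rw [fderiv_chart_comp_patch hf hφ hp hpφ]
  exact (mem_image_iff Θ hφ hpφ _).1 ((hf.tangent p hp _).2 ⟨_, rfl⟩)

/-- The exterior derivative of the inverse of a bivector field on an integral manifold of its image,
in terms of the derivative of the components of the bivector field. -/
theorem extDeriv_inverseOnPatch (Θ : Bivector E M) (hf : IsIntegralPatch Θ.image U f)
    (hφ : φ ∈ IsManifold.maximalAtlas 𝓘(ℝ, E) ∞ M)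
    {p : EuclideanSpace ℝ (Fin k)} (hp : p ∈ U) (hpφ : f p ∈ φ.source)
    {a b c : EuclideanSpace ℝ (Fin k)} {α β γ : E →L[ℝ] ℝ}
    (ha : fderiv ℝ (φ ∘ f) p a = chartRep Θ φ (φ (f p)) γ)
    (hb : fderiv ℝ (φ ∘ f) p b = chartRep Θ φ (φ (f p)) α)
    (hc : fderiv ℝ (φ ∘ f) p c = chartRep Θ φ (φ (f p)) β) :
    extDeriv (Θ.inverseOnPatch hf) p ![a, b, c] =
      β (fderiv ℝ (chartRep Θ φ) (φ (f p)) (chartRep Θ φ (φ (f p)) γ) α) +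
      γ (fderiv ℝ (chartRep Θ φ) (φ (f p)) (chartRep Θ φ (φ (f p)) α) β) +
      α (fderiv ℝ (chartRep Θ φ) (φ (f p)) (chartRep Θ φ (φ (f p)) β) γ) := by
  have hfp := contMDiffAt_of_isIntegralPatch hf hp
  have hev : ∀ᶠ q in 𝓝 p, q ∈ U ∧ f q ∈ φ.source :=
    Filter.inter_mem (hf.isOpen.mem_nhds hp) (hfp.continuousAt (φ.open_source.mem_nhds hpφ))
  refine extDeriv_eq_jacobiator (f := φ ∘ f) (P := chartRep Θ φ)
    ((contMDiffAt_of_mem_maximalAtlas hφ hpφ).comp p hfp).contDiffAt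
    (contDiffAt_chartRep Θ hφ (φ.map_source hpφ)) ?_ ?_ ?_ ?_ ha hb hc
  · intro u v huv
    rw [fderiv_chart_comp_patch hf hφ hp hpφ, fderiv_chart_comp_patch hf hφ hp hpφ] at huv
    exact (fromTangentSpace (𝕜 := ℝ) p).symm.injective
      (hf.immersion p hp (mvfderiv_injective hφ hpφ huv))
  · filter_upwards [hev] with q hq ξ
    exact exists_fderiv_chart_comp_patch Θ hf hφ hq.1 hq.2 ξ
  · exact exists_chartRep_eq_fderiv Θ hf hφ hp hpφ
  · filter_upwards [hev] with q hq u v ξ hξ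
    rw [Function.comp_apply, chartRep_apply_of_mem Θ hq.2,
      fderiv_chart_comp_patch hf hφ hq.1 hq.2] at hξ
    rw [Bivector.inverseOnPatch, dif_pos hq.1, fderiv_chart_comp_patch hf hφ hq.1 hq.2]
    exact inverseForm_apply (Θ.skew (f q)) (ξ ∘L mvfderiv 𝓘(ℝ, E) φ (f q)) ⟨_, _⟩ ⟨_, _⟩
      (mvfderiv_injective hφ hq.2 hξ)

end Patch

/-- A patch through x lies in the leaf of x, by a chain of length one. Its tangent space is Im Θ, so
the vectors Pγ, Pα, Pβ lift to it, and the vanishing of dζ on these lifts is the Jacobi identity. -/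
theorem jacobiAt_of_closed (Θ : Bivector E M) (hI : IsIntegrableDistribution Θ.image)
    (hc : ∀ x : M, Θ.InverseClosedAlong (leaf Θ.image x))
    (hφ : φ ∈ IsManifold.maximalAtlas 𝓘(ℝ, E) ∞ M) {x : M} (hx : x ∈ φ.source) :
    JacobiAt (chartRep Θ φ) (φ x) := by
  intro α β γ
  obtain ⟨k, U, f, hf, p, hp, rfl⟩ := hI x
  have hsub : f '' U ⊆ leaf Θ.image (f p) := fun y hy =>
    Relation.ReflTransGen.single ⟨k, U, f, hf, ⟨p, hp, rfl⟩, hy⟩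
  obtain ⟨a, ha⟩ := exists_fderiv_chart_comp_patch Θ hf hφ hp hx γ
  obtain ⟨b, hb⟩ := exists_fderiv_chart_comp_patch Θ hf hφ hp hx α
  obtain ⟨c, hc'⟩ := exists_fderiv_chart_comp_patch Θ hf hφ hp hx β
  rw [← extDeriv_inverseOnPatch Θ hf hφ hp hx ha hb hc', hc (f p) k U f hf hsub p hp]
  rfl

/-- The components of `Θ` in the chart `φ` are constant. -/
def IsConstantIn (Θ : Bivector E M) (φ : OpenPartialHomeomorph M E)
    (C : (E →L[ℝ] ℝ) →L[ℝ] E) : Prop := ∀ p ∈ φ.target, chartRep Θ φ p = C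

theorem exists_isConstantIn {Θ : Bivector E M} (h : Θ.IsLocallyConstant) (x : M) :
    ∃ φ ∈ IsManifold.maximalAtlas 𝓘(ℝ, E) ∞ M, x ∈ φ.source ∧ ∃ C, IsConstantIn Θ φ C := by
  obtain ⟨φ, hφ, hx, B, hB⟩ := h x
  refine ⟨φ, hφ, hx, chartRep Θ φ (φ x), fun p hp => ?_⟩
  ext α
  rw [← sub_eq_zero]
  refine (Module.forall_dual_apply_eq_zero_iff ℝ _).1 fun β => ?_
  have h1 := hB _ (φ.map_target hp) α (LinearMap.toContinuousLinearMap β)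
  have h2 := hB x hx α (LinearMap.toContinuousLinearMap β)
  rw [map_sub, sub_eq_zero, chartRep_apply_of_mem Θ hx, chartRep_apply]
  exact h1.trans h2.symm

/-- In a chart with constant components C the distribution is the constant subspace `im C`, so
affine slices parallel to it are integral manifolds; restricting to a ball makes them connected. -/
theorem isIntegrableDistribution_of_isLocallyConstant {Θ : Bivector E M}
    (h : Θ.IsLocallyConstant) : IsIntegrableDistribution Θ.image := by
  intro x
  obtain ⟨φ, hφ, hx, C, hC⟩ := exists_isConstantIn h x
  set k := Module.finrank ℝ (im C)
  have hk : Module.finrank ℝ (EuclideanSpace ℝ (Fin k)) = Module.finrank ℝ (im C) := by simp [k]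
  let i : EuclideanSpace ℝ (Fin k) ≃L[ℝ] im C := ContinuousLinearEquiv.ofFinrankEq hk
  let j : EuclideanSpace ℝ (Fin k) →L[ℝ] E := (im C).subtypeL ∘L i
  have hj : Function.Injective j := Subtype.val_injective.comp i.injective
  have hrange : ∀ e, e ∈ im C ↔ ∃ u, j u = e := by
    intro e
    constructor
    · intro he
      exact ⟨i.symm ⟨e, he⟩, by simp [j]⟩
    · rintro ⟨u, rfl⟩
      exact (i u).2
  have hopen : IsOpen ((fun u => φ x + j u) ⁻¹' φ.target) :=
    φ.open_target.preimage (by fun_prop)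
  have h0 : (0 : EuclideanSpace ℝ (Fin k)) ∈ (fun u => φ x + j u) ⁻¹' φ.target := by
    simpa using φ.map_source hx
  obtain ⟨r, hr, hball⟩ := Metric.isOpen_iff.1 hopen 0 h0
  let f : EuclideanSpace ℝ (Fin k) → M := fun u => φ.symm (φ x + j u)
  have hf : ∀ u ∈ Metric.ball (0 : EuclideanSpace ℝ (Fin k)) r,
      ContMDiffAt 𝓘(ℝ, EuclideanSpace ℝ (Fin k)) 𝓘(ℝ, E) ∞ f u := by
    intro u hu
    exact (contMDiffAt_symm_of_mem_maximalAtlas hφ (hball hu)).comp u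
      (ContDiff.contMDiff (by fun_prop)).contMDiffAt
  have hmem : ∀ u ∈ Metric.ball (0 : EuclideanSpace ℝ (Fin k)) r, f u ∈ φ.source :=
    fun u hu => φ.map_target (hball hu)
  have hval : ∀ u ∈ Metric.ball (0 : EuclideanSpace ℝ (Fin k)) r, φ (f u) = φ x + j u :=
    fun u hu => φ.right_inv (hball hu)
  have hd : ∀ u ∈ Metric.ball (0 : EuclideanSpace ℝ (Fin k)) r, ∀ v,
      mvfderiv 𝓘(ℝ, E) φ (f u) (mfderiv 𝓘(ℝ, EuclideanSpace ℝ (Fin k)) 𝓘(ℝ, E) f u v) =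
        j (fromTangentSpace (𝕜 := ℝ) u v) := by
    intro u hu v
    have h1 := mfderiv_comp u
      ((contMDiffAt_of_mem_maximalAtlas hφ (hmem u hu)).mdifferentiableAt (by simp))
      ((hf u hu).mdifferentiableAt (by simp))
    have h2 : φ ∘ f =ᶠ[𝓝 u] fun u => φ x + j u := by
      filter_upwards [Metric.isOpen_ball.mem_nhds hu] with w hw
      exact hval w hw
    have h3 : fderiv ℝ (fun u => φ x + j u) u = j := by
      rw [fderiv_const_add]
      exact j.fderiv
    rw [mfderiv_eq_fderiv, h2.fderiv_eq, h3] at h1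
    exact (DFunLike.congr_fun h1 v).symm
  refine ⟨k, Metric.ball 0 r, f, ⟨Metric.isOpen_ball, ?_, ?_, fun u hu => (hf u hu).contMDiffWithinAt,
    ?_, ?_⟩, 0, Metric.mem_ball_self hr, ?_⟩
  · exact (convex_ball _ _).isConnected ⟨0, Metric.mem_ball_self hr⟩
  · intro u hu v hv huv
    have := congrArg φ huv
    rw [hval u hu, hval v hv] at this
    exact hj (add_left_cancel this)
  · intro u hu v w hvw
    have := congrArg (mvfderiv 𝓘(ℝ, E) φ (f u)) hvw
    rw [hd u hu, hd u hu] at this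
    exact (fromTangentSpace (𝕜 := ℝ) u).injective (hj this)
  · intro u hu v
    rw [mem_image_iff Θ hφ (hmem u hu), hC _ (φ.map_source (hmem u hu))]
    refine (hrange (mvfderiv 𝓘(ℝ, E) φ (f u) v)).trans ?_
    constructor
    · rintro ⟨w, hw⟩
      refine ⟨(fromTangentSpace (𝕜 := ℝ) u).symm w, mvfderiv_injective hφ (hmem u hu) ?_⟩
      rw [hd u hu]
      exact hw
    · rintro ⟨w, rfl⟩
      exact ⟨_, (hd u hu w).symm⟩
  · simp [f, φ.left_inv hx]

/-- Every tangent vector of a patch has the form P ξ, so dζ is determined by the Jacobiator, which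
contains a derivative of the constant components in each term. -/
theorem inverseClosedAlong_of_isLocallyConstant {Θ : Bivector E M}
    (h : Θ.IsLocallyConstant) (L : Set M) : Θ.InverseClosedAlong L := by
  intro k U f hf _ p hp
  obtain ⟨φ, hφ, hx, C, hC⟩ := exists_isConstantIn h (f p)
  have h0 : fderiv ℝ (chartRep Θ φ) (φ (f p)) = 0 := by
    have : chartRep Θ φ =ᶠ[𝓝 (φ (f p))] fun _ => C := by
      filter_upwards [φ.open_target.mem_nhds (φ.map_source hx)] with q hq
      exact hC q hq
    rw [this.fderiv_eq]
    simp
  ext v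
  have hv : v = ![v 0, v 1, v 2] := by
    ext i : 1
    fin_cases i <;> rfl
  obtain ⟨γ, ha⟩ := exists_chartRep_eq_fderiv Θ hf hφ hp hx (v 0)
  obtain ⟨α, hb⟩ := exists_chartRep_eq_fderiv Θ hf hφ hp hx (v 1)
  obtain ⟨β, hc⟩ := exists_chartRep_eq_fderiv Θ hf hφ hp hx (v 2)
  rw [hv, extDeriv_inverseOnPatch Θ hf hφ hp hx ha.symm hb.symm hc.symm, h0]
  simp

end Leaves

/-! ### Christoffel symbols and parallel bivector fields. -/

section Connections

variable {E : Type*} [NormedAddCommGroup E] [NormedSpace ℝ E] [FiniteDimensional ℝ E]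
  {M : Type*} [TopologicalSpace M] [ChartedSpace E M] [IsManifold 𝓘(ℝ, E) ∞ M]
  {φ : OpenPartialHomeomorph M E}

/-- Parallelism is tested on globally smooth 1-forms, so a coordinate form is multiplied by a bump
function supported in the chart. -/
theorem exists_isSmoothOneForm_eventuallyEq [T2Space M]
    (hφ : φ ∈ IsManifold.maximalAtlas 𝓘(ℝ, E) ∞ M)
    {x : M} (hx : x ∈ φ.source) (α : E →L[ℝ] ℝ) :
    ∃ ξ : ∀ x : M, TangentSpace 𝓘(ℝ, E) x →L[ℝ] ℝ, IsSmoothOneForm ξ ∧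
      ∀ᶠ y in 𝓝 x, ξ y = α ∘L mvfderiv 𝓘(ℝ, E) φ y := by
  obtain ⟨ρ, -, hρ⟩ := (SmoothBumpFunction.nhds_basis_tsupport (I := 𝓘(ℝ, E)) x).mem_iff.1
    (φ.open_source.mem_nhds hx)
  refine ⟨fun y => ρ y • (α ∘L mvfderiv 𝓘(ℝ, E) φ y), ?_, ?_⟩
  · exact ContMDiffOn.smul_section_of_tsupport (F := E →L[ℝ] ℝ)
      (V := fun x : M => TangentSpace 𝓘(ℝ, E) x →L[ℝ] ℝ)
      (ρ.contMDiff.of_le (by simp)).contMDiffOn φ.open_source hρ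
      fun y hy => (contMDiffAt_coordForm hφ hy α).contMDiffWithinAt
  · filter_upwards [ρ.eventuallyEq_one] with y hy
    rw [hy]
    exact one_smul ℝ _

omit [FiniteDimensional ℝ E] [IsManifold 𝓘(ℝ, E) ∞ M] in
theorem eventually_mvfderiv_chartField (hφ : φ ∈ IsManifold.maximalAtlas 𝓘(ℝ, E) ∞ M)
    {x : M} (hx : x ∈ φ.source) (e : E) :
    (fun y => mvfderiv 𝓘(ℝ, E) φ y (chartField φ e y)) =ᶠ[𝓝 x] fun _ => e := by
  filter_upwards [φ.open_source.mem_nhds hx] with y hy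
  exact mvfderiv_chartField hφ hy e

theorem mdifferentiableAt_chartField (hφ : φ ∈ IsManifold.maximalAtlas 𝓘(ℝ, E) ∞ M)
    {x : M} (hx : x ∈ φ.source) (e : E) :
    MDifferentiableAt 𝓘(ℝ, E) 𝓘(ℝ, E).tangent (fun y => TotalSpace.mk' E y (chartField φ e y)) x :=
  have : CompleteSpace E := FiniteDimensional.complete ℝ E
  (contMDiffAt_chartField hφ hx e).mdifferentiableAt (by simp)

variable (cov : CovariantDerivative 𝓘(ℝ, E) E (TangentSpace 𝓘(ℝ, E) : M → Type _))

-- The difference of ∇ and the flat derivative of the chart: the terms with dg in the two Leibniz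
-- rules cancel.
omit [FiniteDimensional ℝ E] in
theorem tensorialAt_christoffel (hφ : φ ∈ IsManifold.maximalAtlas 𝓘(ℝ, E) ∞ M)
    {x : M} (hx : x ∈ φ.source) (v : TangentSpace 𝓘(ℝ, E) x) :
    TensorialAt 𝓘(ℝ, E) E (fun Y : ∀ x : M, TangentSpace 𝓘(ℝ, E) x =>
      mvfderiv 𝓘(ℝ, E) φ x (cov Y x v) -
        mvfderiv 𝓘(ℝ, E) (fun y => mvfderiv 𝓘(ℝ, E) φ y (Y y)) x v) x := by
  have hφx := contMDiffAt_of_mem_maximalAtlas hφ hx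
  constructor
  · intro g Y hg hY
    have h1 := mvfderiv_smul hg (mdifferentiableAt_mvfderiv_apply hφx hY)
    have h2 := cov.isCovariantDerivativeOnUniv.leibniz hY hg
    have h3 : (fun y => mvfderiv 𝓘(ℝ, E) φ y ((g • Y) y)) =
        g • fun y => mvfderiv 𝓘(ℝ, E) φ y (Y y) := by
      ext y
      simp
    rw [h3, h1, h2]
    simp [smul_sub]
  · intro Y Y' hY hY'
    have h1 := mvfderiv_add (mdifferentiableAt_mvfderiv_apply hφx hY)
      (mdifferentiableAt_mvfderiv_apply hφx hY')
    have h2 := cov.isCovariantDerivativeOnUniv.add hY hY'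
    have h3 : (fun y => mvfderiv 𝓘(ℝ, E) φ y ((Y + Y') y)) =
        (fun y => mvfderiv 𝓘(ℝ, E) φ y (Y y)) + fun y => mvfderiv 𝓘(ℝ, E) φ y (Y' y) := by
      ext y
      simp
    rw [h3, h1, h2]
    simp
    abel

/-- The Christoffel symbols of a connection in a chart. -/
def christoffel (φ : OpenPartialHomeomorph M E) (x : M) (a b : E) : E :=
  mvfderiv 𝓘(ℝ, E) φ x (cov (chartField φ b) x (chartField φ a x))

/-- By tensoriality, Y may be replaced in the difference of the two derivatives by the coordinate
field with the same value at x, whose flat derivative vanishes. -/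
theorem mvfderiv_cov_apply (hφ : φ ∈ IsManifold.maximalAtlas 𝓘(ℝ, E) ∞ M)
    {x : M} (hx : x ∈ φ.source) (a : E) {Y : ∀ x : M, TangentSpace 𝓘(ℝ, E) x}
    (hY : MDifferentiableAt 𝓘(ℝ, E) 𝓘(ℝ, E).tangent (fun y => TotalSpace.mk' E y (Y y)) x) :
    mvfderiv 𝓘(ℝ, E) φ x (cov Y x (chartField φ a x)) =
      mvfderiv 𝓘(ℝ, E) (fun y => mvfderiv 𝓘(ℝ, E) φ y (Y y)) x (chartField φ a x) +
      christoffel cov φ x a (mvfderiv 𝓘(ℝ, E) φ x (Y x)) := by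
  have h := (tensorialAt_christoffel cov hφ hx (chartField φ a x)).pointwise hY
    (mdifferentiableAt_chartField hφ hx (mvfderiv 𝓘(ℝ, E) φ x (Y x)))
    (chartField_mvfderiv hφ hx (Y x)).symm
  rw [mvfderiv_congr (eventually_mvfderiv_chartField hφ hx _), mvfderiv_const] at h
  rw [christoffel, ← sub_eq_iff_eq_add', h]
  simp

/-- Coordinate fields commute, so zero torsion leaves only the symmetry of the symbols. -/
theorem christoffel_symm (ht : cov.torsion = 0) (hφ : φ ∈ IsManifold.maximalAtlas 𝓘(ℝ, E) ∞ M)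
    {x : M} (hx : x ∈ φ.source) (a b : E) :
    christoffel cov φ x a b = christoffel cov φ x b a := by
  have ha := mdifferentiableAt_chartField hφ hx a
  have hb := mdifferentiableAt_chartField hφ hx b
  have h := congrArg (mvfderiv 𝓘(ℝ, E) φ x)
    (cov.torsion_eq_zero_iff.1 ht (X := chartField φ a) (Y := chartField φ b) ha hb)
  rw [mvfderiv_mlieBracket hφ hx ha hb, mvfderiv_congr (eventually_mvfderiv_chartField hφ hx _),
    mvfderiv_congr (eventually_mvfderiv_chartField hφ hx _), mvfderiv_const, mvfderiv_const,
    map_sub] at h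
  rw [christoffel, christoffel, ← sub_eq_zero, h]
  simp

variable {cov}

/-- On a coordinate form α, ∇Θ = 0 reads (∂ₐP)α + Γ(a, Pα) = Pη with η = ∇ₐα = -α(Γ(a, ·)). Pairing
with β and using β(Pη) = -η(Pβ) gives the formula. -/
theorem fderiv_chartRep_of_isParallel [T2Space M] {Θ : Bivector E M} (hp : Θ.IsParallel cov)
    (hφ : φ ∈ IsManifold.maximalAtlas 𝓘(ℝ, E) ∞ M) {x : M} (hx : x ∈ φ.source)
    (a : E) (α β : E →L[ℝ] ℝ) :
    β (fderiv ℝ (chartRep Θ φ) (φ x) a α) =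
      α (christoffel cov φ x a (chartRep Θ φ (φ x) β)) -
      β (christoffel cov φ x a (chartRep Θ φ (φ x) α)) := by
  obtain ⟨ξ, hξ, hξα⟩ := exists_isSmoothOneForm_eventuallyEq hφ hx α
  obtain ⟨η, hη⟩ := exists_coordForm hφ hx (dualDeriv cov ξ hξ x (chartField φ a x))
  have hη' : ∀ b, η b = -α (christoffel cov φ x a b) := by
    intro b
    have h1 : dualDeriv cov ξ hξ x (chartField φ a x) (chartField φ b x) = _ :=
      TensorialAt.mkHom_apply (tensorialAt_dualDeriv cov hξ x (chartField φ a x))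
        (mdifferentiableAt_chartField hφ hx b)
    have h2 : (fun y => ξ y (chartField φ b y)) =ᶠ[𝓝 x] fun _ => α b := by
      filter_upwards [hξα, eventually_mvfderiv_chartField hφ hx b] with y h3 h4
      rw [h3]
      exact congrArg α h4
    rw [← hη, mvfderiv_congr h2, mvfderiv_const, hξα.self_of_nhds] at h1
    have h5 : (η ∘L mvfderiv 𝓘(ℝ, E) φ x) (chartField φ b x) = η b :=
      congrArg η (mvfderiv_chartField hφ hx b)
    rw [h5] at h1
    rw [h1]
    simp [christoffel]
  have hY : ContMDiffAt 𝓘(ℝ, E) 𝓘(ℝ, E).tangent ∞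
      (fun y => TotalSpace.mk' E y (Θ.toFun y (ξ y))) x := contMDiffAt_bivector_apply Θ (hξ x)
  have h := congrArg (mvfderiv 𝓘(ℝ, E) φ x) (hp ξ hξ x (chartField φ a x))
  rw [mvfderiv_cov_apply cov hφ hx a (hY.mdifferentiableAt (by simp)), ← hη,
    ← chartRep_apply_of_mem Θ hx, hξα.self_of_nhds, ← chartRep_apply_of_mem Θ hx,
    ← fderiv_comp_chart_symm hφ hx (mdifferentiableAt_mvfderiv_apply
      (contMDiffAt_of_mem_maximalAtlas hφ hx) (hY.mdifferentiableAt (by simp))),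
    mvfderiv_chartField hφ hx] at h
  have hφx := φ.map_source hx
  have h6 : (fun y => mvfderiv 𝓘(ℝ, E) φ y (Θ.toFun y (ξ y))) ∘ φ.symm =ᶠ[𝓝 (φ x)]
      fun p => chartRep Θ φ p α := by
    have hc : ContinuousAt φ.symm (φ x) := φ.continuousAt_symm hφx
    have := hc.eventually (by rwa [φ.left_inv hx])
    filter_upwards [this] with p hp
    rw [Function.comp_apply, hp, chartRep_apply]
  have h7 : fderiv ℝ (fun p => chartRep Θ φ p α) (φ x) a =
      fderiv ℝ (chartRep Θ φ) (φ x) a α :=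
    DFunLike.congr_fun (hasFDerivAt_apply_const
      ((contDiffAt_chartRep Θ hφ hφx).differentiableAt (by simp)).hasFDerivAt α).fderiv a
  rw [h6.fderiv_eq, h7] at h
  have h8 := isSkew_chartRep Θ φ (φ x) η β
  rw [← h, map_add, hη'] at h8
  linarith

theorem jacobiAt_of_isParallel [T2Space M] {Θ : Bivector E M} (ht : cov.torsion = 0)
    (hp : Θ.IsParallel cov) (hφ : φ ∈ IsManifold.maximalAtlas 𝓘(ℝ, E) ∞ M) {x : M}
    (hx : x ∈ φ.source) : JacobiAt (chartRep Θ φ) (φ x) := by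
  intro α β γ
  simp only [fderiv_chartRep_of_isParallel hp hφ hx]
  rw [christoffel_symm cov ht hφ hx (chartRep Θ φ (φ x) γ) (chartRep Θ φ (φ x) β),
    christoffel_symm cov ht hφ hx (chartRep Θ φ (φ x) γ) (chartRep Θ φ (φ x) α),
    christoffel_symm cov ht hφ hx (chartRep Θ φ (φ x) α) (chartRep Θ φ (φ x) β)]
  ring

end Connections

/-! ### The flat connection of a chart. -/

section FlatConnections

variable {E : Type*} [NormedAddCommGroup E] [NormedSpace ℝ E] [FiniteDimensional ℝ E]
  {F : Type*} [NormedAddCommGroup F] [NormedSpace ℝ F]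
  {M : Type*} [TopologicalSpace M] [ChartedSpace E M]

/-- A linear map on E is recovered from its values on a basis by a fixed continuous linear map. -/
theorem contMDiffAt_clm_of_apply {G : M → E →L[ℝ] F} {x : M}
    (h : ∀ e, ContMDiffAt 𝓘(ℝ, E) 𝓘(ℝ, F) ∞ (fun y => G y e) x) :
    ContMDiffAt 𝓘(ℝ, E) 𝓘(ℝ, E →L[ℝ] F) ∞ G x := by
  let b := Module.finBasis ℝ E
  let T : (Fin (Module.finrank ℝ E) → F) →L[ℝ] E →L[ℝ] F :=
    ∑ i, (ContinuousLinearMap.smulRightL ℝ E F (LinearMap.toContinuousLinearMap (b.coord i))) ∘L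
      ContinuousLinearMap.proj i
  have hT : G = T ∘ fun y i => G y (b i) := by
    ext y e
    have h1 := congrArg (G y) (b.sum_repr e)
    rw [map_sum] at h1
    rw [← h1]
    simp [T]
  rw [hT]
  exact T.contDiff.contMDiff.contMDiffAt.comp x (contMDiffAt_pi_space.2 fun i => h (b i))

variable [IsManifold 𝓘(ℝ, E) ∞ M] {φ : OpenPartialHomeomorph M E}

/-- A field of endomorphisms of the tangent spaces is smooth if it is smooth on coordinate
fields. -/
theorem contMDiffAt_endomorphism {L : ∀ x : M, TangentSpace 𝓘(ℝ, E) x →L[ℝ] TangentSpace 𝓘(ℝ, E) x}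
    {x : M} (h : ∀ e, ContMDiffAt 𝓘(ℝ, E) 𝓘(ℝ, E).tangent ∞
      (fun y => TotalSpace.mk' E y (L y (chartField (chartAt E x) e y))) x) :
    ContMDiffAt 𝓘(ℝ, E) (𝓘(ℝ, E).prod 𝓘(ℝ, E →L[ℝ] E)) ∞
      (fun y => TotalSpace.mk' (E →L[ℝ] E)
        (E := fun y : M => TangentSpace 𝓘(ℝ, E) y →L[ℝ] TangentSpace 𝓘(ℝ, E) y) y (L y)) x := by
  have hφ : chartAt E x ∈ IsManifold.maximalAtlas 𝓘(ℝ, E) ∞ M := IsManifold.chart_mem_maximalAtlas x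
  have hx : x ∈ (chartAt E x).source := mem_chart_source E x
  rw [contMDiffAt_hom_bundle]
  refine ⟨contMDiffAt_id, contMDiffAt_clm_of_apply fun e => ?_⟩
  refine (contMDiffAt_mvfderiv_apply (contMDiffAt_of_mem_maximalAtlas hφ hx)
    (h e)).congr_of_eventuallyEq ?_
  filter_upwards [(chartAt E x).open_source.mem_nhds hx] with y hy
  have hb : y ∈ (trivializationAt E (TangentSpace 𝓘(ℝ, E) : M → Type _) x).baseSet := by
    simpa using hy
  -- The preferred trivialization of TM at x is the derivative of the preferred chart at x, so its
  -- local frame consists of coordinate fields.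
  have h1 : (trivializationAt E (TangentSpace 𝓘(ℝ, E)) x).continuousLinearMapAt ℝ y =
      mvfderiv 𝓘(ℝ, E) (chartAt E x) y := by
    rw [TangentBundle.continuousLinearMapAt_trivializationAt hy]
    rfl
  have h2 : (trivializationAt E (TangentSpace 𝓘(ℝ, E)) x).symmL ℝ y e =
      chartField (chartAt E x) e y := by
    apply mvfderiv_injective hφ hy
    rw [mvfderiv_chartField hφ hy, ← h1, Trivialization.continuousLinearMapAt_symmL _ hb]
  change (trivializationAt E (TangentSpace 𝓘(ℝ, E)) x).continuousLinearMapAt ℝ y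
    (L y ((trivializationAt E (TangentSpace 𝓘(ℝ, E)) x).symmL ℝ y e)) = _
  rw [h1, h2]

omit [FiniteDimensional ℝ E] in
theorem mvfderiv_clm_apply {G : M → E →L[ℝ] F} {g : M → E} {x : M}
    (hG : MDifferentiableAt 𝓘(ℝ, E) 𝓘(ℝ, E →L[ℝ] F) G x)
    (hg : MDifferentiableAt 𝓘(ℝ, E) 𝓘(ℝ, E) g x) (v : TangentSpace 𝓘(ℝ, E) x) :
    mvfderiv 𝓘(ℝ, E) (fun y => G y (g y)) x v =
      mvfderiv 𝓘(ℝ, E) G x v (g x) + G x (mvfderiv 𝓘(ℝ, E) g x v) := by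
  have hφ : chartAt E x ∈ IsManifold.maximalAtlas 𝓘(ℝ, E) ∞ M := IsManifold.chart_mem_maximalAtlas x
  have hx : x ∈ (chartAt E x).source := mem_chart_source E x
  have hsymm := (mdifferentiable_of_mem_maximalAtlas hφ).mdifferentiableAt_symm
    ((chartAt E x).map_source hx)
  have hl := (chartAt E x).left_inv hx
  have hG' : DifferentiableAt ℝ (G ∘ (chartAt E x).symm) (chartAt E x x) := by
    rw [← mdifferentiableAt_iff_differentiableAt]
    exact MDifferentiableAt.comp _ (by rwa [hl]) hsymm
  have hg' : DifferentiableAt ℝ (g ∘ (chartAt E x).symm) (chartAt E x x) := by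
    rw [← mdifferentiableAt_iff_differentiableAt]
    exact MDifferentiableAt.comp _ (by rwa [hl]) hsymm
  rw [← fderiv_comp_chart_symm hφ hx hG, ← fderiv_comp_chart_symm hφ hx hg,
    ← fderiv_comp_chart_symm hφ hx (hG.clm_apply hg)]
  have := fderiv_clm_apply hG' hg'
  change fderiv ℝ (fun p => (G ∘ (chartAt E x).symm) p ((g ∘ (chartAt E x).symm) p)) _ _ = _
  rw [this]
  simp [hl, add_comm]

/-- The flat connection given by a chart. -/
def flatDeriv (φ : OpenPartialHomeomorph M E) (Y : ∀ x : M, TangentSpace 𝓘(ℝ, E) x) (x : M) :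
    TangentSpace 𝓘(ℝ, E) x →L[ℝ] TangentSpace 𝓘(ℝ, E) x :=
  (mvfderiv 𝓘(ℝ, E) φ x).inverse ∘L
    mvfderiv 𝓘(ℝ, E) (fun y => mvfderiv 𝓘(ℝ, E) φ y (Y y)) x

omit [FiniteDimensional ℝ E] [IsManifold 𝓘(ℝ, E) ∞ M] in
theorem flatDeriv_apply (φ : OpenPartialHomeomorph M E) (Y : ∀ x : M, TangentSpace 𝓘(ℝ, E) x)
    (x : M) (v : TangentSpace 𝓘(ℝ, E) x) : flatDeriv φ Y x v =
      chartField φ (mvfderiv 𝓘(ℝ, E) (fun y => mvfderiv 𝓘(ℝ, E) φ y (Y y)) x v) x := rfl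

omit [FiniteDimensional ℝ E] [IsManifold 𝓘(ℝ, E) ∞ M] in
theorem mvfderiv_flatDeriv (hφ : φ ∈ IsManifold.maximalAtlas 𝓘(ℝ, E) ∞ M) {x : M}
    (hx : x ∈ φ.source) (Y : ∀ x : M, TangentSpace 𝓘(ℝ, E) x) (v : TangentSpace 𝓘(ℝ, E) x) :
    mvfderiv 𝓘(ℝ, E) φ x (flatDeriv φ Y x v) =
      mvfderiv 𝓘(ℝ, E) (fun y => mvfderiv 𝓘(ℝ, E) φ y (Y y)) x v := by
  rw [flatDeriv_apply, mvfderiv_chartField hφ hx]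

omit [FiniteDimensional ℝ E] in
theorem isCovariantDerivativeOn_flatDeriv (hφ : φ ∈ IsManifold.maximalAtlas 𝓘(ℝ, E) ∞ M) :
    IsCovariantDerivativeOn (I := 𝓘(ℝ, E)) E
      (V := (TangentSpace 𝓘(ℝ, E) : M → Type _)) (flatDeriv φ) φ.source where
  add {Y Y' x} hY hY' hx := by
    have hφx := contMDiffAt_of_mem_maximalAtlas hφ hx
    have h1 := mvfderiv_add (mdifferentiableAt_mvfderiv_apply hφx hY)
      (mdifferentiableAt_mvfderiv_apply hφx hY')
    have h3 : (fun y => mvfderiv 𝓘(ℝ, E) φ y ((Y + Y') y)) =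
        (fun y => mvfderiv 𝓘(ℝ, E) φ y (Y y)) + fun y => mvfderiv 𝓘(ℝ, E) φ y (Y' y) := by
      ext y
      simp
    rw [flatDeriv, h3, h1, ContinuousLinearMap.comp_add]
    rfl
  leibniz {Y g x} hY hg hx := by
    have hφx := contMDiffAt_of_mem_maximalAtlas hφ hx
    have h1 := mvfderiv_smul hg (mdifferentiableAt_mvfderiv_apply hφx hY)
    have h3 : (fun y => mvfderiv 𝓘(ℝ, E) φ y ((g • Y) y)) =
        g • fun y => mvfderiv 𝓘(ℝ, E) φ y (Y y) := by
      ext y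
      simp
    ext v
    apply mvfderiv_injective hφ hx
    rw [mvfderiv_flatDeriv hφ hx, h3, h1]
    simp [mvfderiv_flatDeriv hφ hx]

theorem contMDiffAt_flatDeriv (hφ : φ ∈ IsManifold.maximalAtlas 𝓘(ℝ, E) ∞ M)
    {Y : ∀ x : M, TangentSpace 𝓘(ℝ, E) x} {x : M} (hx : x ∈ φ.source)
    (hY : ContMDiffAt 𝓘(ℝ, E) 𝓘(ℝ, E).tangent ∞ (fun y => TotalSpace.mk' E y (Y y)) x) :
    ContMDiffAt 𝓘(ℝ, E) (𝓘(ℝ, E).prod 𝓘(ℝ, E →L[ℝ] E)) ∞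
      (fun y => TotalSpace.mk' (E →L[ℝ] E)
        (E := fun y : M => TangentSpace 𝓘(ℝ, E) y →L[ℝ] TangentSpace 𝓘(ℝ, E) y) y
          (flatDeriv φ Y y)) x := by
  have : CompleteSpace E := FiniteDimensional.complete ℝ E
  refine contMDiffAt_endomorphism fun e => ?_
  exact contMDiffAt_chartField_apply hφ hx (contMDiffAt_mvfderiv_apply
    (contMDiffAt_mvfderiv_apply (contMDiffAt_of_mem_maximalAtlas hφ hx) hY)
    (contMDiffAt_chartField (IsManifold.chart_mem_maximalAtlas x) (mem_chart_source E x) e))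

/-- Torsion-freeness of the flat connection: this is the coordinate formula for the Lie bracket. -/
theorem flatDeriv_sub_eq_mlieBracket (hφ : φ ∈ IsManifold.maximalAtlas 𝓘(ℝ, E) ∞ M)
    {X Y : ∀ x : M, TangentSpace 𝓘(ℝ, E) x} {x : M} (hx : x ∈ φ.source)
    (hX : MDifferentiableAt 𝓘(ℝ, E) 𝓘(ℝ, E).tangent (fun y => TotalSpace.mk' E y (X y)) x)
    (hY : MDifferentiableAt 𝓘(ℝ, E) 𝓘(ℝ, E).tangent (fun y => TotalSpace.mk' E y (Y y)) x) :
    flatDeriv φ Y x (X x) - flatDeriv φ X x (Y x) = VectorField.mlieBracket 𝓘(ℝ, E) X Y x := by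
  apply mvfderiv_injective hφ hx
  rw [map_sub, mvfderiv_flatDeriv hφ hx, mvfderiv_flatDeriv hφ hx, mvfderiv_mlieBracket hφ hx hX hY]

/-- A bivector field with constant components in a chart is parallel for the flat connection of that
chart. -/
theorem exists_dual_flatDeriv {Θ : Bivector E M} {C : (E →L[ℝ] ℝ) →L[ℝ] E}
    (hφ : φ ∈ IsManifold.maximalAtlas 𝓘(ℝ, E) ∞ M) (hC : IsConstantIn Θ φ C)
    {ξ : ∀ x : M, TangentSpace 𝓘(ℝ, E) x →L[ℝ] ℝ} (hξ : IsSmoothOneForm ξ) {x : M}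
    (hx : x ∈ φ.source) (v : TangentSpace 𝓘(ℝ, E) x) :
    ∃ η : TangentSpace 𝓘(ℝ, E) x →L[ℝ] ℝ,
      flatDeriv φ (fun y => Θ.toFun y (ξ y)) x v = Θ.toFun x η ∧
      ∀ W : ∀ x : M, TangentSpace 𝓘(ℝ, E) x,
        MDifferentiableAt 𝓘(ℝ, E) 𝓘(ℝ, E).tangent (fun y => TotalSpace.mk' E y (W y)) x →
        mvfderiv 𝓘(ℝ, E) (fun y => ξ y (W y)) x v - ξ x (flatDeriv φ W x v) = η (W x) := by
  have : CompleteSpace E := FiniteDimensional.complete ℝ E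
  have hφx := contMDiffAt_of_mem_maximalAtlas hφ hx
  -- A is ξ read in the chart, a function with values in the fixed space E*, and the flat dual
  -- derivative of ξ is dA(v). It is produced as a covector η because `flatDeriv φ` is a connection
  -- only on the source of φ, to which `dualDeriv` does not apply.
  let A : M → E →L[ℝ] ℝ := fun y => ξ y ∘L (mvfderiv 𝓘(ℝ, E) φ y).inverse
  have hA : MDifferentiableAt 𝓘(ℝ, E) 𝓘(ℝ, E →L[ℝ] ℝ) A x := by
    refine (contMDiffAt_clm_of_apply fun e => ?_).mdifferentiableAt (by simp)
    have h := (hξ x).clm_bundle_apply (F₁ := E) (F₂ := ℝ)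
      (E₁ := (TangentSpace 𝓘(ℝ, E) : M → Type _)) (E₂ := Bundle.Trivial M ℝ) (b := id)
      (v := chartField φ e) (contMDiffAt_chartField hφ hx e)
    exact ((contMDiffAt_totalSpace).1 h).2
  have hAξ : ∀ y ∈ φ.source, ∀ w, A y (mvfderiv 𝓘(ℝ, E) φ y w) = ξ y w := fun y hy w =>
    congrArg (ξ y) (chartField_mvfderiv hφ hy w)
  have hsrc : ∀ᶠ y in 𝓝 x, y ∈ φ.source := φ.open_source.mem_nhds hx
  refine ⟨mvfderiv 𝓘(ℝ, E) A x v ∘L mvfderiv 𝓘(ℝ, E) φ x, ?_, fun W hW => ?_⟩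
  · apply mvfderiv_injective hφ hx
    rw [mvfderiv_flatDeriv hφ hx, ← chartRep_apply_of_mem Θ hx, hC _ (φ.map_source hx)]
    have h1 : (fun y => mvfderiv 𝓘(ℝ, E) φ y (Θ.toFun y (ξ y))) =ᶠ[𝓝 x] C ∘ A := by
      filter_upwards [hsrc] with y hy
      rw [Function.comp_apply, ← hC _ (φ.map_source hy), chartRep_apply_of_mem Θ hy]
      congr 2
      ext w
      exact (hAξ y hy w).symm
    rw [mvfderiv_congr h1]
    have h2 := mfderiv_comp x (C.differentiableAt (x := A x)).mdifferentiableAt hA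
    rw [mfderiv_eq_fderiv, C.fderiv] at h2
    exact DFunLike.congr_fun h2 v
  · have h1 : (fun y => ξ y (W y)) =ᶠ[𝓝 x] fun y => A y (mvfderiv 𝓘(ℝ, E) φ y (W y)) := by
      filter_upwards [hsrc] with y hy
      exact (hAξ y hy _).symm
    rw [mvfderiv_congr h1, mvfderiv_clm_apply hA (mdifferentiableAt_mvfderiv_apply hφx hW),
      ← mvfderiv_flatDeriv hφ hx, hAξ x hx]
    simp

end FlatConnections

/-! ### Gluing flat connections by a partition of unity. -/

section Gluing

variable {E : Type*} [NormedAddCommGroup E] [NormedSpace ℝ E] [FiniteDimensional ℝ E]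
  {M : Type*} [TopologicalSpace M] [ChartedSpace E M] [IsManifold 𝓘(ℝ, E) ∞ M]

/-- The Leibniz rule, zero torsion and ∇Θ = 0 are affine conditions on a connection, hence inherited
by a combination whose weights sum to 1. Each is satisfied by the flat connection of a chart with
constant components. -/
theorem isIntegrable_of_isLocallyConstant [T2Space M] [SecondCountableTopology M]
    {Θ : Bivector E M} (h : Θ.IsLocallyConstant) : Θ.IsIntegrable := by
  have : LocallyCompactSpace M := ChartedSpace.locallyCompactSpace E M
  choose φ hφ hxφ C hC using fun x => exists_isConstantIn h x
  obtain ⟨ρ, hρ⟩ := SmoothPartitionOfUnity.exists_isSubordinate 𝓘(ℝ, E) (s := (univ : Set M))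
    isClosed_univ (fun i => (φ i).source) (fun i => (φ i).open_source)
    fun x _ => mem_iUnion.2 ⟨x, hxφ x⟩
  have hmem : ∀ {x : M} {i : M}, i ∈ ρ.finsupport x → x ∈ (φ i).source := by
    intro x i hi
    rw [SmoothPartitionOfUnity.mem_finsupport] at hi
    exact hρ i (subset_tsupport _ hi)
  have hsum : ∀ x, ∑ i ∈ ρ.finsupport x, ρ i x = 1 := fun x => ρ.sum_finsupport x (mem_univ x)
  -- Only indices with nonzero weight at x enter, and x lies in the source of their charts; the
  -- values of `flatDeriv (φ i)` elsewhere play no role.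
  let D : (∀ x : M, TangentSpace 𝓘(ℝ, E) x) →
      ∀ x : M, TangentSpace 𝓘(ℝ, E) x →L[ℝ] TangentSpace 𝓘(ℝ, E) x :=
    fun Y x => ∑ i ∈ ρ.finsupport x, ρ i x • flatDeriv (φ i) Y x
  have hD : ∀ Y x v, D Y x v = ∑ i ∈ ρ.finsupport x, ρ i x • flatDeriv (φ i) Y x v := by
    intro Y x v
    simp [D]
  let cov : CovariantDerivative 𝓘(ℝ, E) E (TangentSpace 𝓘(ℝ, E) : M → Type _) :=
    { toFun := D
      isCovariantDerivativeOnUniv :=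
        { add := by
            intro Y Y' x hY hY' _
            simp only [D]
            rw [← Finset.sum_add_distrib]
            refine Finset.sum_congr rfl fun i hi => ?_
            rw [(isCovariantDerivativeOn_flatDeriv (hφ i)).add hY hY' (hmem hi), smul_add]
          leibniz := by
            intro Y g x hY hg _
            simp only [D]
            rw [Finset.sum_congr rfl fun i hi => by
              rw [(isCovariantDerivativeOn_flatDeriv (hφ i)).leibniz hY hg (hmem hi), smul_add]]
            rw [Finset.sum_add_distrib, ← Finset.sum_smul, hsum, one_smul, Finset.smul_sum]
            congr 1
            exact Finset.sum_congr rfl fun i _ => smul_comm _ _ _ } }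
  refine ⟨cov, ⟨⟨fun {Y} hY => ?_⟩⟩, ?_, ?_⟩
  · rw [contMDiffOn_univ] at hY ⊢
    have h1 := ContMDiff.finsum_section_of_locallyFinite (𝕜 := ℝ) (I := 𝓘(ℝ, E)) (n := ∞)
      (F := E →L[ℝ] E) (V := fun y : M => TangentSpace 𝓘(ℝ, E) y →L[ℝ] TangentSpace 𝓘(ℝ, E) y)
      (t := fun i x => ρ i x • flatDeriv (φ i) Y x)
      (ρ.locallyFinite.subset fun i x hx hx' => hx (by
        simp only [hx']
        exact zero_smul ℝ _))
      fun i => ContMDiffOn.smul_section_of_tsupport (F := E →L[ℝ] E)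
        (V := fun y : M => TangentSpace 𝓘(ℝ, E) y →L[ℝ] TangentSpace 𝓘(ℝ, E) y)
        (ρ i).contMDiff.contMDiffOn (φ i).open_source (hρ i)
        fun y hy => (contMDiffAt_flatDeriv (hφ i) hy (hY y)).contMDiffWithinAt
    -- The index set of the sum defining D varies with x; the locally finite sum over all indices
    -- agrees with it and is visibly smooth.
    convert h1 using 3 with x
    refine (finsum_eq_sum_of_support_subset _ fun i hi => ?_).symm
    rw [SmoothPartitionOfUnity.coe_finsupport]
    intro h0
    apply hi
    simp only [h0]
    exact zero_smul ℝ _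
  · rw [CovariantDerivative.torsion_eq_zero_iff]
    intro X Y x hX hY
    change D Y x (X x) - D X x (Y x) = _
    rw [hD, hD, ← Finset.sum_sub_distrib, Finset.sum_congr rfl fun i hi => by
      rw [← smul_sub, flatDeriv_sub_eq_mlieBracket (hφ i) (hmem hi) hX hY],
      ← Finset.sum_smul, hsum, one_smul]
  · intro ξ hξ x v
    choose! η hη hη' using fun i (hi : x ∈ (φ i).source) =>
      exists_dual_flatDeriv (hφ i) (hC i) hξ hi v
    -- The term d(ξ W)(v) carries no weight; writing 1 as the sum of the ρᵢ distributes it over the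
    -- charts.
    have hdual : dualDeriv cov ξ hξ x v = ∑ i ∈ ρ.finsupport x, ρ i x • η i := by
      ext w
      have hch : chartAt E x ∈ IsManifold.maximalAtlas 𝓘(ℝ, E) ∞ M :=
        IsManifold.chart_mem_maximalAtlas x
      have hx : x ∈ (chartAt E x).source := mem_chart_source E x
      obtain ⟨W, hW, rfl⟩ : ∃ W : ∀ x : M, TangentSpace 𝓘(ℝ, E) x,
          MDifferentiableAt 𝓘(ℝ, E) 𝓘(ℝ, E).tangent (fun y => TotalSpace.mk' E y (W y)) x ∧
          W x = w :=
        ⟨_, mdifferentiableAt_chartField hch hx _, chartField_mvfderiv hch hx w⟩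
      have h1 : dualDeriv cov ξ hξ x v (W x) = _ :=
        TensorialAt.mkHom_apply (tensorialAt_dualDeriv cov hξ x v) hW
      rw [h1]
      change _ - ξ x (D W x v) = _
      rw [hD, map_sum, sum_apply]
      conv_lhs => rw [← one_smul ℝ (mvfderiv 𝓘(ℝ, E) (fun y => ξ y (W y)) x v), ← hsum x,
        Finset.sum_smul, ← Finset.sum_sub_distrib]
      refine Finset.sum_congr rfl fun i hi => ?_
      rw [map_smul, ← smul_sub, hη' i (hmem hi) W hW]
      rfl
    rw [hdual, map_sum]
    change D _ x v = _
    rw [hD]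
    refine Finset.sum_congr rfl fun i hi => ?_
    rw [hη i (hmem hi), map_smul]

end Gluing

end BivectorFields

end

/-! ### The equivalence, through the Jacobi identity. -/

theorem propositionF {E : Type*} [NormedAddCommGroup E] [NormedSpace ℝ E] [FiniteDimensional ℝ E]
    {M : Type*} [TopologicalSpace M] [ChartedSpace E M] [IsManifold 𝓘(ℝ, E) ∞ M]
    [T2Space M] [SecondCountableTopology M]
    (Θ : BivectorFields.Bivector E M) (hΘ : Θ.HasConstantRank) :
    (Θ.IsLocallyConstant ↔ Θ.IsIntegrable) ∧
    (Θ.IsIntegrable ↔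
      BivectorFields.IsIntegrableDistribution Θ.image ∧
        ∀ x : M, Θ.InverseClosedAlong (BivectorFields.leaf Θ.image x)) := by
  have hLC : (∀ φ ∈ IsManifold.maximalAtlas 𝓘(ℝ, E) ∞ M, ∀ x ∈ φ.source,
      BivectorFields.JacobiAt (BivectorFields.chartRep Θ φ) (φ x)) → Θ.IsLocallyConstant :=
    BivectorFields.isLocallyConstant_of_jacobiAt Θ hΘ
  have hba : Θ.IsIntegrable → Θ.IsLocallyConstant := fun ⟨_, _, ht, hp⟩ =>
    hLC fun _ hφ _ hx => BivectorFields.jacobiAt_of_isParallel ht hp hφ hx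
  refine ⟨⟨BivectorFields.isIntegrable_of_isLocallyConstant, hba⟩, fun h => ?_, fun h => ?_⟩
  · exact ⟨BivectorFields.isIntegrableDistribution_of_isLocallyConstant (hba h),
      fun x => BivectorFields.inverseClosedAlong_of_isLocallyConstant (hba h) _⟩
  · exact BivectorFields.isIntegrable_of_isLocallyConstant
      (hLC fun _ hφ _ hx => BivectorFields.jacobiAt_of_closed Θ h.1 h.2 hφ hx)
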